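/- **Setting.** Consider the directed graph on the nodes $1,\dots,6$ with edges $1\to3$, $1\to5$, $1\to6$, $2\to4$, $2\to5$, $2\to6$, $3\to5$, $4\to6$. Every node counts as an ancestor and a descendant of itself. Let $T$ be a finite horizon. The state $x_t=(x^1_t,\dots,x^6_t)$ is split into one block per node, and node 3 is the only decision maker, with input $u^3_t$ and measurement $y^3_t$; all dimensions may be zero and may vary with time. For $0\le t\le T-1$, $$x_{t+1}=A_tx_t+B_tu^3_t+w_t,\qquad y^3_t=C_tx_t+v^3_t,$$ where the block matrices conform to the graph (a block from node $j$ to node $i$ vanishes unless there is a path from $j$ to $i$): the nonzero blocks are among $A_{11},A_{22},A_{31},A_{33},A_{42},A_{44},A_{51},A_{52},A_{53},A_{55},A_{61},A_{62},A_{64},A_{66}$, $B_{33},B_{53}$ and $C_{31},C_{33}$. The vectors $x_0,(w_0,v^3_0),\dots,(w_{T-1},v^3_{T-1})$ are mutually independent and Gaussian with mean zero, $x_0$ with covariance $\Sigma_{\rm init}$ and $(w_t,v^3_t)$ with covariance $\begin{bmatrix}W_t&U_t^{\mathsf T}\\U_t&V_t\end{bmatrix}$. With the information $i^3_t=(y^3_{0:t-1},u^3_{0:t-1})$,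 a control strategy is a family of measurable functions $f_t$, the input is $u^3_t=f_t(i^3_t)$, and a strategy is admissible if all $u^3_t$ have finite second moments. The problem is to minimize, over the admissible strategies, $$\mathbb E\Bigl(\sum_{t=0}^{T-1}\begin{bmatrix}x_t\\u^3_t\end{bmatrix}^{\mathsf T}\begin{bmatrix}Q_t&S_t\\S_t^{\mathsf T}&R_t\end{bmatrix}\begin{bmatrix}x_t\\u^3_t\end{bmatrix}+x_T^{\mathsf T}P_{\rm final}x_T\Bigr),$$ where $\begin{bmatrix}Q_t&S_t\\S_t^{\mathsf T}&R_t\end{bmatrix}$ and $P_{\rm final}$ are symmetric positive semidefinite. Assumption A2 holds: if nodes $i,j$ have no common ancestor, then the $(i,j)$ blocks of all $W_t,V_t,U_t,\Sigma_{\rm init}$ vanish; if they have no common descendant, then the $(i,j)$ blocks of all $Q_t,R_t,S_t,P_{\rm final}$ vanish. For a strategy write $z_t=(z^1_t,z^3_t,z^5_t)=\mathbb E\bigl[(x^1,x^3,x^5)_t\mid i^3_t\bigr]$ for the estimate formed under this strategy. **Theorem.** There are matrices $K_t$ and $L_t$ $(0\le t\le T-1)$ depending only on the parameters of the problem such that: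 1. There is an optimal strategy, and it satisfies $u^3_t=K_tz_t$ almost surely for $0\le t\le T-1$. If all $R_t$ are positive definite, every optimal strategy satisfies $u^3_t=K_tz_t$ almost surely for $0\le t\le T-1$. 2. Under every admissible strategy, with the same gains $L_t$ for all of them, almost surely for $0\le t\le T-1$, $$z_{t+1}=\begin{bmatrix}A_{11}&0&0\\A_{31}&A_{33}&0\\A_{51}&A_{53}&A_{55}\end{bmatrix}_tz_t+\begin{bmatrix}0\\B_{33}\\B_{53}\end{bmatrix}_tu^3_t-L_t\Bigl(y^3_t-\begin{bmatrix}C_{31}&C_{33}\end{bmatrix}_t\begin{bmatrix}z^1_t\\z^3_t\end{bmatrix}\Bigr).$$ -/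

import Mathlib

open MeasureTheory ProbabilityTheory

namespace SixNode

/-! ### The six-node graph -/

/-- The nodes of the six-node graph. -/
inductive Node : Type
  | n1 | n2 | n3 | n4 | n5 | n6
  deriving DecidableEq

instance : Fintype Node where
  elems := {.n1, .n2, .n3, .n4, .n5, .n6}
  complete := by intro x; cases x <;> decide

/-- The directed edges of the six-node graph. -/
inductive Edge : Node → Node → Prop
  | e13 : Edge .n1 .n3
  | e15 : Edge .n1 .n5
  | e16 : Edge .n1 .n6
  | e24 : Edge .n2 .n4
  | e25 : Edge .n2 .n5
  | e26 : Edge .n2 .n6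
  | e35 : Edge .n3 .n5
  | e46 : Edge .n4 .n6

/-- `Path i j`: there is a directed path (possibly of length zero) from `i` to `j`. -/
def Path (i j : Node) : Prop := Relation.ReflTransGen Edge i j

/-- Two nodes have a common ancestor (a node is an ancestor of itself). -/
def CommonAncestor (i j : Node) : Prop := ∃ k, Path k i ∧ Path k j

/-- Two nodes have a common descendant (a node is a descendant of itself). -/
def CommonDescendant (i j : Node) : Prop := ∃ k, Path i k ∧ Path j k

/-- The ancestors of node 3. -/
def anc3 : Finset Node := {.n1, .n3}

/-- The nodes path-connected to node 3 (its ancestors and descendants). -/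
def funnel3 : Finset Node := {.n1, .n3, .n5}

/-! ### Parameters of the problem -/

/-- Coordinates of a global state whose `i`-th block has dimension `d i`. -/
abbrev StateIdx (d : Node → ℕ) : Type := Σ i : Node, Fin (d i)

/-- Coordinates of the subvector formed by the blocks with index in `s`. -/
abbrev SubIdx (d : Node → ℕ) (s : Finset Node) : Type := {a : StateIdx d // a.1 ∈ s}

/-- The data of the problem: the horizon `T`, the (possibly time-varying) dimensions of the
states, of the input `u³` and of the measurement `y³`, and the matrices of the dynamics, of
the cost and of the Gaussian primitive variables. Only the times `t < T` matter for the
time-indexed matrices. Here `U t` is the covariance of `v_t` with `w_t`. -/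
structure Params where
  T : ℕ
  n : ℕ → Node → ℕ
  m : ℕ → ℕ
  p : ℕ → ℕ
  A : ∀ t, Matrix (StateIdx (n (t + 1))) (StateIdx (n t)) ℝ
  B : ∀ t, Matrix (StateIdx (n (t + 1))) (Fin (m t)) ℝ
  C : ∀ t, Matrix (Fin (p t)) (StateIdx (n t)) ℝ
  Q : ∀ t, Matrix (StateIdx (n t)) (StateIdx (n t)) ℝ
  S : ∀ t, Matrix (StateIdx (n t)) (Fin (m t)) ℝ
  R : ∀ t, Matrix (Fin (m t)) (Fin (m t)) ℝ
  Pfinal : Matrix (StateIdx (n T)) (StateIdx (n T)) ℝ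
  W : ∀ t, Matrix (StateIdx (n (t + 1))) (StateIdx (n (t + 1))) ℝ
  U : ∀ t, Matrix (Fin (p t)) (StateIdx (n (t + 1))) ℝ
  V : ∀ t, Matrix (Fin (p t)) (Fin (p t)) ℝ
  Sinit : Matrix (StateIdx (n 0)) (StateIdx (n 0)) ℝ

namespace Params

variable (Θ : Params)

/-- Values of the global state at time `t`. -/
abbrev StateSp (t : ℕ) : Type := StateIdx (Θ.n t) → ℝ

/-- Values of the input of node 3 at time `t`. -/
abbrev InputSp (t : ℕ) : Type := Fin (Θ.m t) → ℝ

/-- Values of the measurement of node 3 at time `t`. -/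
abbrev OutputSp (t : ℕ) : Type := Fin (Θ.p t) → ℝ

/-- The blocks of `A`, `B`, `C` conform to the graph: the block `(i, j)` vanishes unless there
is a path from `j` to `i`. Inputs and measurements exist at node 3 only. -/
structure ConformsToGraph : Prop where
  A_zero : ∀ t < Θ.T, ∀ i j, ¬ Path j i → ∀ a b, Θ.A t ⟨i, a⟩ ⟨j, b⟩ = 0
  B_zero : ∀ t < Θ.T, ∀ i, ¬ Path .n3 i → ∀ a b, Θ.B t ⟨i, a⟩ b = 0
  C_zero : ∀ t < Θ.T, ∀ j, ¬ Path j .n3 → ∀ a b, Θ.C t a ⟨j, b⟩ = 0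

/-- The `(i, j)` blocks of all cost matrices vanish. -/
structure DecoupledCost (i j : Node) : Prop where
  Q_zero : ∀ t < Θ.T, ∀ a b, Θ.Q t ⟨i, a⟩ ⟨j, b⟩ = 0
  S_zero : j = .n3 → ∀ t < Θ.T, ∀ a b, Θ.S t ⟨i, a⟩ b = 0
  R_zero : i = .n3 → j = .n3 → ∀ t < Θ.T, Θ.R t = 0
  P_zero : ∀ a b, Θ.Pfinal ⟨i, a⟩ ⟨j, b⟩ = 0

/-- The `(i, j)` blocks of all covariance matrices vanish. -/
structure UncorrelatedNoise (i j : Node) : Prop where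
  W_zero : ∀ t < Θ.T, ∀ a b, Θ.W t ⟨i, a⟩ ⟨j, b⟩ = 0
  U_zero : i = .n3 → ∀ t < Θ.T, ∀ a b, Θ.U t a ⟨j, b⟩ = 0
  V_zero : i = .n3 → j = .n3 → ∀ t < Θ.T, Θ.V t = 0
  Sinit_zero : ∀ a b, Θ.Sinit ⟨i, a⟩ ⟨j, b⟩ = 0

/-- Assumption A2: nodes without a common ancestor have uncorrelated noise, and nodes without
a common descendant have decoupled cost. -/
def AssumptionA2 : Prop :=
  ∀ i j, (¬ CommonAncestor i j → Θ.UncorrelatedNoise i j) ∧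
    (¬ CommonDescendant i j → Θ.DecoupledCost i j)

/-- The quadratic cost is convex: its weights are symmetric positive semidefinite. -/
def CostPosSemidef : Prop :=
  (∀ t < Θ.T, (Matrix.fromBlocks (Θ.Q t) (Θ.S t) (Θ.S t).transpose (Θ.R t)).PosSemidef) ∧
    Θ.Pfinal.PosSemidef

/-- The matrices given as covariance matrices are symmetric positive semidefinite. -/
def CovPosSemidef : Prop :=
  (∀ t < Θ.T, (Matrix.fromBlocks (Θ.W t) (Θ.U t).transpose (Θ.U t) (Θ.V t)).PosSemidef) ∧
    Θ.Sinit.PosSemidef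

/-! ### Strategies and closed loop -/

/-- Values of the information `(y_{0:t-1}, u_{0:t-1})` of node 3 at time `t`. -/
abbrev History (t : ℕ) : Type :=
  (∀ s : Fin t, Θ.OutputSp s) × (∀ s : Fin t, Θ.InputSp s)

/-- A control strategy of node 3: a measurable function of the available information for
each time. -/
structure Strategy where
  act : ∀ t, Θ.History t → Θ.InputSp t
  measurable_act : ∀ t, Measurable (act t)

variable {Ω : Type*}

/-- The primitive random vectors: initial state, process noise, measurement noise. -/
structure Primitives (Ω : Type*) where
  x0 : Ω → Θ.StateSp 0
  w : ∀ t, Ω → Θ.StateSp (t + 1)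
  v : ∀ t, Ω → Θ.OutputSp t

variable {Θ}

/-- The primitive random vectors have the prescribed joint law: `x_0` and the pairs
`(w_t, v_t)`, `t < T`, are mutually independent centered Gaussian vectors with covariance
matrices `Sinit` and `[W_t, U_tᵀ; U_t, V_t]`. -/
structure Primitives.HasLQGLaw [MeasurableSpace Ω] (ξ : Θ.Primitives Ω) (μ : Measure Ω) :
    Prop where
  measurable_x0 : Measurable ξ.x0
  measurable_w : ∀ t < Θ.T, Measurable (ξ.w t)
  measurable_v : ∀ t < Θ.T, Measurable (ξ.v t)
  gaussian_x0 : HasGaussianLaw ξ.x0 μ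
  mean_x0 : ∀ a, ∫ ω, ξ.x0 ω a ∂μ = 0
  cov_x0 : ∀ a b, ∫ ω, ξ.x0 ω a * ξ.x0 ω b ∂μ = Θ.Sinit a b
  gaussian_wv : ∀ t < Θ.T, HasGaussianLaw (fun ω => (ξ.w t ω, ξ.v t ω)) μ
  mean_w : ∀ t < Θ.T, ∀ a, ∫ ω, ξ.w t ω a ∂μ = 0
  mean_v : ∀ t < Θ.T, ∀ a, ∫ ω, ξ.v t ω a ∂μ = 0
  cov_w : ∀ t < Θ.T, ∀ a b, ∫ ω, ξ.w t ω a * ξ.w t ω b ∂μ = Θ.W t a b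
  cov_vw : ∀ t < Θ.T, ∀ a b, ∫ ω, ξ.v t ω a * ξ.w t ω b ∂μ = Θ.U t a b
  cov_v : ∀ t < Θ.T, ∀ a b, ∫ ω, ξ.v t ω a * ξ.v t ω b ∂μ = Θ.V t a b
  indep : iIndep (fun k : Option (Fin Θ.T) =>
    k.elim (MeasurableSpace.comap ξ.x0 inferInstance)
      (fun t => MeasurableSpace.comap (fun ω => (ξ.w t ω, ξ.v t ω)) inferInstance)) μ

/-- One outcome of the closed loop under the strategy `f`: the state at time `t` together
with the information of node 3 at time `t`. -/
noncomputable def traj (f : Θ.Strategy) (ξ : Θ.Primitives Ω) (ω : Ω) :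
    (t : ℕ) → Θ.StateSp t × Θ.History t
  | 0 => (ξ.x0 ω, (fun s => s.elim0, fun s => s.elim0))
  | t + 1 =>
    let x := (traj f ξ ω t).1
    let i := (traj f ξ ω t).2
    let u := f.act t i
    let y := (Θ.C t).mulVec x + ξ.v t ω
    ((Θ.A t).mulVec x + (Θ.B t).mulVec u + ξ.w t ω,
      (Fin.snoc (α := fun s : Fin (t + 1) => Θ.OutputSp s) i.1 y,
        Fin.snoc (α := fun s : Fin (t + 1) => Θ.InputSp s) i.2 u))

/-- The state process `x_t`. -/
noncomputable def state (f : Θ.Strategy) (ξ : Θ.Primitives Ω) (t : ℕ) (ω : Ω) : Θ.StateSp t :=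
  (traj f ξ ω t).1

/-- The information process `i³_t = (y³_{0:t-1}, u³_{0:t-1})`. -/
noncomputable def info (f : Θ.Strategy) (ξ : Θ.Primitives Ω) (t : ℕ) (ω : Ω) : Θ.History t :=
  (traj f ξ ω t).2

/-- The input process `u³_t = f_t(i³_t)`. -/
noncomputable def input (f : Θ.Strategy) (ξ : Θ.Primitives Ω) (t : ℕ) (ω : Ω) : Θ.InputSp t :=
  f.act t (info f ξ t ω)

/-- The measurement process `y³_t = C_t x_t + v_t`. -/
noncomputable def output (f : Θ.Strategy) (ξ : Θ.Primitives Ω) (t : ℕ) (ω : Ω) :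
    Θ.OutputSp t :=
  (Θ.C t).mulVec (state f ξ t ω) + ξ.v t ω

/-- The σ-algebra generated by the information of node 3 at time `t`. -/
@[reducible]
noncomputable def infoSigma (f : Θ.Strategy) (ξ : Θ.Primitives Ω) (t : ℕ) : MeasurableSpace Ω :=
  MeasurableSpace.comap (info f ξ t) inferInstance

/-- The estimate `E[x^s_t | i³_t]` of the subvector of the state with blocks in `s`. -/
noncomputable def estimate [MeasurableSpace Ω] (μ : Measure Ω) (f : Θ.Strategy)
    (ξ : Θ.Primitives Ω) (s : Finset Node) (t : ℕ) : Ω → SubIdx (Θ.n t) s → ℝ :=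
  μ[fun ω (a : SubIdx (Θ.n t) s) => state f ξ t ω a.1 | infoSigma f ξ t]

/-- A strategy is admissible if the inputs it generates have finite second moments. -/
def Admissible [MeasurableSpace Ω] (μ : Measure Ω) (ξ : Θ.Primitives Ω) (f : Θ.Strategy) :
    Prop :=
  ∀ t < Θ.T, MemLp (input f ξ t) 2 μ

/-- The quadratic form `zᵀ M z`. -/
def quad {ι : Type*} [Fintype ι] (M : Matrix ι ι ℝ) (z : ι → ℝ) : ℝ :=
  z ⬝ᵥ M.mulVec z

/-- The expected finite-horizon quadratic cost of the strategy `f`. -/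
noncomputable def cost [MeasurableSpace Ω] (μ : Measure Ω) (ξ : Θ.Primitives Ω)
    (f : Θ.Strategy) : ℝ :=
  ∫ ω, ((∑ t ∈ Finset.range Θ.T,
      quad (Matrix.fromBlocks (Θ.Q t) (Θ.S t) (Θ.S t).transpose (Θ.R t))
        (Sum.elim (state f ξ t ω) (input f ξ t ω)))
    + quad Θ.Pfinal (state f ξ Θ.T ω)) ∂μ

/-- `f` is an optimal strategy: it is admissible and minimizes the expected cost among all
admissible strategies. -/
def Optimal [MeasurableSpace Ω] (μ : Measure Ω) (ξ : Θ.Primitives Ω) (f : Θ.Strategy) : Prop :=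
  Admissible μ ξ f ∧ ∀ g : Θ.Strategy, Admissible μ ξ g → cost μ ξ f ≤ cost μ ξ g

end Params

end SixNode

/-! The proof is the separation principle for a single controller on the full state, followed by a
proof that nodes 2, 4 and 6 drop out of the resulting control law.

Filtering: the Kalman recursion `filt` is a function of the information, and `err`, the state minus
`filt`, does not depend on the strategy, because the input cancels. The filter gain makes the new
error uncorrelated with the innovation, hence independent of it by joint Gaussianity. By induction
the error is independent of the information under every strategy (`indepFun_err_info`), so `filt` is
the conditional mean (`estimate_ae_eq`).

Control: let `P` solve the backward Riccati recursion. Completing the square (`quad_sumElim`) and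
telescoping turn the cost into a constant plus the expectations of nonnegative quadratic forms in u
- K `filt` (`cost_eq`). The law u = K `filt` makes these forms vanish and is optimal. When all R are
positive definite, so are the forms, and every optimal strategy must follow this law.

Reduction: nodes 2 and 4 receive nothing from node 3 and share no ancestor with 1 and 3, so their
estimates are zero. Node 6 shares no descendant with 3 and 5, so its column of K is zero. Both facts
are zero patterns preserved by a Riccati step (`schur_lift_apply_eq_zero`), one for the forward
recursion and one for the backward recursion. Only nodes 1, 3 and 5 remain. -/

namespace SixNode

open Matrix

/-! ### Riccati steps for semidefinite block matrices -/

section LinearAlgebra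

variable {ι ι' κ : Type*} [Fintype ι] [Fintype ι'] [Fintype κ]

/-- The range of `Xᵀ` is contained in the range of `Xᵀ X`. -/
lemma exists_transpose_mul_self_mulVec_eq (X : Matrix ι κ ℝ) (v : ι → ℝ) :
    ∃ z, (Xᵀ * X) *ᵥ z = Xᵀ *ᵥ v := by
  have hle : LinearMap.range (Xᵀ * X).mulVecLin ≤ LinearMap.range Xᵀ.mulVecLin := by
    rw [Matrix.mulVecLin_mul]
    exact LinearMap.range_comp_le_range _ _
  have heq := Submodule.eq_of_le_of_finrank_eq hle (by
    change (Xᵀ * X).rank = Xᵀ.rank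
    rw [Matrix.rank_transpose_mul_self, Matrix.rank_transpose])
  have hv : Xᵀ *ᵥ v ∈ LinearMap.range (Xᵀ * X).mulVecLin := heq ▸ ⟨v, rfl⟩
  exact hv

-- Writing J as XᵀX, with X₁ and X₂ the two column blocks of X, turns the equation into the normal
-- equations X₂ᵀX₂ K = -X₂ᵀX₁, which are always solvable. This replaces an inverse when J₂₂ is
-- singular. Solutions are then not unique, so the vanishing of columns is built into the choice;
-- the zero patterns of the gains rely on it.
open scoped MatrixOrder Matrix.Norms.L2Operator in
lemma exists_gain {J : Matrix (ι ⊕ κ) (ι ⊕ κ) ℝ} (hJ : J.PosSemidef) :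
    ∃ K : Matrix κ ι ℝ, J.toBlocks₂₂ * K = -J.toBlocks₂₁ ∧
      ∀ i, (∀ k, J.toBlocks₂₁ k i = 0) → ∀ k, K k i = 0 := by
  classical
  obtain ⟨X, rfl⟩ : ∃ X : Matrix (ι ⊕ κ) (ι ⊕ κ) ℝ, J = Xᵀ * X := by
    obtain ⟨X, hX⟩ := CStarAlgebra.nonneg_iff_eq_star_mul_self.mp hJ.nonneg
    exact ⟨X, hX⟩
  have key : ∀ i, ∃ z : κ → ℝ, (Xᵀ * X).toBlocks₂₂ *ᵥ z = (fun k => -(Xᵀ * X).toBlocks₂₁ k i) ∧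
      ((∀ k, (Xᵀ * X).toBlocks₂₁ k i = 0) → z = 0) := by
    intro i
    by_cases h0 : ∀ k, (Xᵀ * X).toBlocks₂₁ k i = 0
    · exact ⟨0, by ext k; simp [h0 k], fun _ => rfl⟩
    · obtain ⟨z, hz⟩ := exists_transpose_mul_self_mulVec_eq (X.submatrix id Sum.inr)
        (fun j => -X j (Sum.inl i))
      refine ⟨z, ?_, fun h => absurd h h0⟩
      ext k
      have := congrFun hz k
      simpa [Matrix.mulVec, dotProduct, Matrix.mul_apply, Matrix.toBlocks₂₂, Matrix.toBlocks₂₁]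
        using this
  choose z hz hz0 using key
  refine ⟨Matrix.of fun k i => z i k, ?_, fun i hi k => by simp [hz0 i hi]⟩
  ext k i
  have := congrFun (hz i) k
  simpa [Matrix.mulVec, dotProduct, Matrix.mul_apply] using this

open Classical in
/-- A solution `K` of `J₂₂ K = -J₂₁` whose `i`-th column vanishes if that of `J₂₁` does. -/
noncomputable def gain (J : Matrix (ι ⊕ κ) (ι ⊕ κ) ℝ) : Matrix κ ι ℝ :=
  if h : J.PosSemidef then (exists_gain h).choose else 0

lemma toBlocks₂₂_mul_gain {J : Matrix (ι ⊕ κ) (ι ⊕ κ) ℝ} (h : J.PosSemidef) :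
    J.toBlocks₂₂ * gain J = -J.toBlocks₂₁ := by
  rw [gain, dif_pos h]
  exact (exists_gain h).choose_spec.1

lemma gain_apply_eq_zero {J : Matrix (ι ⊕ κ) (ι ⊕ κ) ℝ} (h : J.PosSemidef) {i : ι}
    (hi : ∀ k, J.toBlocks₂₁ k i = 0) (k : κ) : gain J k i = 0 := by
  rw [gain, dif_pos h]
  exact (exists_gain h).choose_spec.2 i hi k

/-- The matrix `G S Gᵀ + N`. -/
def lift (G : Matrix ι ι' ℝ) (N : Matrix ι ι ℝ) (S : Matrix ι' ι' ℝ) : Matrix ι ι ℝ :=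
  G * S * Gᵀ + N

lemma lift_posSemidef {G : Matrix ι ι' ℝ} {N : Matrix ι ι ℝ} {S : Matrix ι' ι' ℝ}
    (hN : N.PosSemidef) (hS : S.PosSemidef) : (lift G N S).PosSemidef := by
  have := hS.mul_mul_conjTranspose_same G
  rw [conjTranspose_eq_transpose_of_trivial] at this
  exact this.add hN

/-- With Gᵀ = [A B], this merges the stage cost and the cost-to-go of the predicted next state into
one quadratic form in (x, u). -/
lemma quad_lift (G : Matrix ι ι' ℝ) (N : Matrix ι ι ℝ) (S : Matrix ι' ι' ℝ) (z : ι → ℝ) :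
    Params.quad (lift G N S) z = Params.quad S (Gᵀ *ᵥ z) + Params.quad N z := by
  simp only [Params.quad, lift, add_mulVec, dotProduct_add, ← mulVec_mulVec]
  rw [dotProduct_mulVec z G, ← mulVec_transpose]

lemma mulVec_apply_eq_zero {α : Type*} {M : Matrix α ι ℝ} {x : ι → ℝ} {a : α}
    (h : ∀ i, M a i * x i = 0) : (M *ᵥ x) a = 0 :=
  Finset.sum_eq_zero fun i _ => h i

/-- Columns of `M` may be dropped where the product with `x` vanishes. -/
lemma submatrix_mulVec_subtype {p : ι → Prop} [Fintype {i // p i}] {α β : Type*}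
    (M : Matrix α ι ℝ) (r : β → α) (x : ι → ℝ) (b : β) (h : ∀ i, ¬ p i → M (r b) i * x i = 0) :
    (M.submatrix r Subtype.val *ᵥ fun i : {i // p i} => x i) b = (M *ᵥ x) (r b) := by
  classical
  simp only [mulVec, dotProduct, submatrix_apply]
  rw [← Finset.sum_subtype (Finset.univ.filter p) (by simp) (fun i => M (r b) i * x i)]
  exact Finset.sum_subset (Finset.subset_univ _) fun i _ hi => h i (by simpa using hi)

variable [DecidableEq ι]

/-- The Schur complement step of the Riccati recursions: `[1 Kᵀ] J [1; K]` with `K = gain J`. -/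
noncomputable def schur (J : Matrix (ι ⊕ κ) (ι ⊕ κ) ℝ) : Matrix ι ι ℝ :=
  fromCols (1 : Matrix ι ι ℝ) (gain J)ᵀ * J * (fromCols (1 : Matrix ι ι ℝ) (gain J)ᵀ)ᵀ

lemma schur_posSemidef {J : Matrix (ι ⊕ κ) (ι ⊕ κ) ℝ} (hJ : J.PosSemidef) :
    (schur J).PosSemidef := by
  have := hJ.mul_mul_conjTranspose_same (fromCols (1 : Matrix ι ι ℝ) (gain J)ᵀ)
  rwa [conjTranspose_eq_transpose_of_trivial] at this

/-- The congruence has four terms; the two with a left factor Kᵀ cancel because J₂₁ + J₂₂K = 0. -/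
lemma schur_eq {J : Matrix (ι ⊕ κ) (ι ⊕ κ) ℝ} (hJ : J.PosSemidef) :
    schur J = J.toBlocks₁₁ + J.toBlocks₁₂ * gain J := by
  have h := toBlocks₂₂_mul_gain hJ
  rw [schur, transpose_fromCols, transpose_transpose, transpose_one, Matrix.mul_assoc]
  generalize gain J = K at h ⊢
  conv_lhs => rw [← fromBlocks_toBlocks J]
  rw [← fromRows_fromCols_eq_fromBlocks, fromRows_mul, fromCols_mul_fromRows,
    fromCols_mul_fromRows, fromCols_mul_fromRows, h]
  simp

/-- Propagation of a zero pattern through a Riccati step. -/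
lemma schur_lift_apply_eq_zero {G : Matrix (ι ⊕ κ) ι' ℝ} {N : Matrix (ι ⊕ κ) (ι ⊕ κ) ℝ}
    {S : Matrix ι' ι' ℝ} (hN : N.PosSemidef) (hS : S.PosSemidef)
    {p q : ι → Prop} {p' q' : ι' → Prop}
    (hS0 : ∀ c d, p' c → q' d → S c d = 0)
    (hGp : ∀ a c, p a → ¬ p' c → G (.inl a) c = 0)
    (hGq : ∀ b d, q b → ¬ q' d → G (.inl b) d = 0)
    (hGk : ∀ k d, ¬ q' d → G (.inr k) d = 0)
    (hNq : ∀ a b, p a → q b → N (.inl a) (.inl b) = 0)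
    (hNk : ∀ a k, p a → N (.inl a) (.inr k) = 0) :
    (∀ a b, p a → q b → schur (lift G N S) a b = 0) ∧
      ∀ k a, p a → gain (lift G N S) k a = 0 := by
  have hJ := lift_posSemidef (G := G) hN hS
  have aux : ∀ a (r : ι ⊕ κ), p a → (∀ d, ¬ q' d → G r d = 0) →
      (G * S * Gᵀ) (.inl a) r = 0 := by
    intro a r ha hr
    rw [Matrix.mul_apply]
    refine Finset.sum_eq_zero fun d _ => ?_
    by_cases hd : q' d
    · rw [Matrix.mul_apply, Finset.sum_eq_zero, zero_mul]
      intro c _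
      by_cases hc : p' c
      · rw [hS0 c d hc hd, mul_zero]
      · rw [hGp a c ha hc, zero_mul]
    · rw [transpose_apply, hr d hd, mul_zero]
  have h12 : ∀ a k, p a → lift G N S (.inl a) (.inr k) = 0 := fun a k ha => by
    rw [lift, Matrix.add_apply, aux a _ ha (hGk k), hNk a k ha, add_zero]
  have h11 : ∀ a b, p a → q b → lift G N S (.inl a) (.inl b) = 0 := fun a b ha hb => by
    rw [lift, Matrix.add_apply, aux a _ ha (fun d => hGq b d hb), hNq a b ha hb, add_zero]
  refine ⟨fun a b ha hb => ?_, fun k a ha => ?_⟩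
  -- The row of J₁₂ at a is zero, so nothing about column b of the gain is needed.
  · rw [schur_eq hJ, Matrix.add_apply, Matrix.mul_apply]
    simp [toBlocks₁₁, toBlocks₁₂, h11 a b ha hb, h12 a _ ha]
  · refine gain_apply_eq_zero hJ (fun k => ?_) k
    have := hJ.isHermitian.apply (.inr k) (.inl a)
    rw [star_trivial, h12 a k ha] at this
    exact this.symm

/-- Completion of squares. -/
lemma quad_sumElim {J : Matrix (ι ⊕ κ) (ι ⊕ κ) ℝ} (hJ : J.PosSemidef) (x : ι → ℝ) (u : κ → ℝ) :
    Params.quad J (Sum.elim x u) =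
      Params.quad (schur J) x + Params.quad J.toBlocks₂₂ (u - gain J *ᵥ x) := by
  have h := toBlocks₂₂_mul_gain hJ
  have hsym : J.toBlocks₁₂ = J.toBlocks₂₁ᵀ := by
    ext i k
    exact (hJ.isHermitian.apply (.inl i) (.inr k)).symm
  have hsym2 : J.toBlocks₂₂ᵀ = J.toBlocks₂₂ := by
    ext i k
    exact hJ.isHermitian.apply (.inr i) (.inr k)
  have h21 : J.toBlocks₂₁ = -(J.toBlocks₂₂ * gain J) := by rw [h, neg_neg]
  rw [schur_eq hJ]
  unfold Params.quad
  conv_lhs => rw [← fromBlocks_toBlocks J]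
  rw [fromBlocks_mulVec, sumElim_dotProduct_sumElim]
  simp only [Sum.elim_comp_inl, Sum.elim_comp_inr]
  rw [hsym, h21, transpose_neg, transpose_mul, hsym2]
  set D := J.toBlocks₂₂
  set K := gain J
  have e1 : ∀ y : κ → ℝ, x ⬝ᵥ (Kᵀ *ᵥ y) = (K *ᵥ x) ⬝ᵥ y := fun y => by
    rw [dotProduct_mulVec, vecMul_transpose]
  have e2 : ∀ y z : κ → ℝ, y ⬝ᵥ (D *ᵥ z) = z ⬝ᵥ (D *ᵥ y) := fun y z => by
    rw [dotProduct_mulVec, dotProduct_comm, ← mulVec_transpose, hsym2]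
  simp only [add_mulVec, neg_mulVec, Matrix.neg_mul, ← mulVec_mulVec, dotProduct_add, dotProduct_neg,
    mulVec_sub, dotProduct_sub, sub_dotProduct, e1]
  rw [e2 (K *ᵥ x) u]
  ring

/-- The transformation `[1 Kᵀ; 0 1]` with `K = gain J`. -/
noncomputable def decorrelate [DecidableEq κ] (J : Matrix (ι ⊕ κ) (ι ⊕ κ) ℝ) :
    Matrix (ι ⊕ κ) (ι ⊕ κ) ℝ :=
  fromBlocks 1 (gain J)ᵀ 0 1

/-- The transformation `[1 Kᵀ; 0 1]` with `K = gain J` decorrelates the two blocks of `J`. -/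
lemma decorrelate_apply [DecidableEq κ] {J : Matrix (ι ⊕ κ) (ι ⊕ κ) ℝ} (hJ : J.PosSemidef)
    (i : ι) (k : κ) :
    (decorrelate J * J * (decorrelate J)ᵀ) (.inl i) (.inr k) = 0 := by
  have h := congrFun (congrFun (toBlocks₂₂_mul_gain hJ) k) i
  have h12 : J.toBlocks₁₂ i k = J.toBlocks₂₁ k i := (hJ.isHermitian.apply (.inl i) (.inr k)).symm
  have hsym : J.toBlocks₂₂ᵀ = J.toBlocks₂₂ := by
    ext a b
    exact hJ.isHermitian.apply (.inr a) (.inr b)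
  rw [decorrelate]
  generalize gain J = K at h ⊢
  conv_lhs => rw [← fromBlocks_toBlocks J]
  rw [fromBlocks_transpose, fromBlocks_multiply, fromBlocks_multiply, fromBlocks_apply₁₂]
  simp only [transpose_zero, transpose_one, Matrix.one_mul, Matrix.mul_one, Matrix.mul_zero,
    Matrix.add_apply]
  rw [← hsym, ← transpose_mul, transpose_apply, h, h12, Matrix.neg_apply, add_neg_cancel, Matrix.zero_apply, add_zero]

end LinearAlgebra

/-! ### Recursion backward from the horizon -/

/-- Backward recursion with prescribed final value. -/
lemma exists_backward_recursion {X : ℕ → Type*} [∀ t, Nonempty (X t)]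
    (step : ∀ t, X (t + 1) → X t) (T : ℕ) (xT : X T) :
    ∃ x : ∀ t, X t, x T = xT ∧ ∀ t < T, x t = step t (x (t + 1)) := by
  classical
  induction T generalizing X with
  | zero =>
    -- Values beyond the horizon are arbitrary.
    exact ⟨fun t => Nat.casesOn t xT fun _ => Classical.arbitrary _, rfl, fun t ht => by omega⟩
  | succ T ih =>
    -- Solve the problem shifted by one time step, then prepend the value at time 0. The final value
    -- keeps its type, with no transport along an equality of times.
    obtain ⟨x, hx, hstep⟩ := ih (X := fun t => X (t + 1)) (fun t => step (t + 1)) xT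
    refine ⟨fun t => match t with
      | 0 => step 0 (x 0)
      | t + 1 => x t, hx, fun t ht => ?_⟩
    cases t with
    | zero => rfl
    | succ t => exact hstep t (by omega)

/-! ### Second moments and independence -/

section Probability

variable {Ω : Type*} [MeasurableSpace Ω] {μ : Measure Ω}
variable {ι ι' κ : Type*} [Fintype ι] [Fintype ι'] [Fintype κ]

lemma measurable_mulVec (G : Matrix ι' ι ℝ) : Measurable fun x : ι → ℝ => G *ᵥ x :=
  (continuous_const.matrix_mulVec continuous_id).measurable

lemma memLp_mulVec {X : Ω → ι → ℝ} (hX : MemLp X 2 μ) (G : Matrix ι' ι ℝ) :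
    MemLp (fun ω => G *ᵥ X ω) 2 μ :=
  (LinearMap.toContinuousLinearMap G.mulVecLin).comp_memLp' hX

lemma integrable_mul_apply {X : Ω → ι → ℝ} {Y : Ω → κ → ℝ} (hX : MemLp X 2 μ) (hY : MemLp Y 2 μ)
    (i : ι) (k : κ) : Integrable (fun ω => X ω i * Y ω k) μ :=
  (hX.eval i).integrable_mul (hY.eval k)

lemma integrable_dotProduct_mulVec {X : Ω → ι → ℝ} {Y : Ω → κ → ℝ} (M : Matrix ι κ ℝ)
    (hX : MemLp X 2 μ) (hY : MemLp Y 2 μ) : Integrable (fun ω => X ω ⬝ᵥ M *ᵥ Y ω) μ := by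
  simp only [dotProduct]
  exact integrable_finsetSum _ fun i _ => integrable_mul_apply hX (memLp_mulVec hY M) i i

lemma integrable_quad {X : Ω → ι → ℝ} (M : Matrix ι ι ℝ) (hX : MemLp X 2 μ) :
    Integrable (fun ω => Params.quad M (X ω)) μ :=
  integrable_dotProduct_mulVec M hX hX

/-- A bilinear form in independent vectors, one of which is centered, has mean zero. -/
lemma integral_dotProduct_mulVec_of_indepFun {X : Ω → ι → ℝ} {Y : Ω → κ → ℝ} (M : Matrix ι κ ℝ)
    (hX : MemLp X 2 μ) (hY : MemLp Y 2 μ) (hXY : IndepFun X Y μ) (h0 : ∀ k, ∫ ω, Y ω k ∂μ = 0) :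
    ∫ ω, X ω ⬝ᵥ M *ᵥ Y ω ∂μ = 0 := by
  simp only [dotProduct, mulVec, Finset.mul_sum]
  rw [integral_finsetSum _ fun i _ => integrable_finsetSum _ fun k _ => by
    simpa only [mul_left_comm] using (integrable_mul_apply hX hY i k).const_mul (M i k)]
  refine Finset.sum_eq_zero fun i _ => ?_
  rw [integral_finsetSum _ fun k _ => by
    simpa only [mul_left_comm] using (integrable_mul_apply hX hY i k).const_mul (M i k)]
  refine Finset.sum_eq_zero fun k _ => ?_
  have hik : IndepFun (fun ω => X ω i) (fun ω => Y ω k) μ :=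
    hXY.comp (measurable_pi_apply i) (measurable_pi_apply k)
  simp only [mul_left_comm (X _ i) (M i k)]
  rw [integral_const_mul, hik.integral_fun_mul_eq_mul_integral
    (hX.eval i).aestronglyMeasurable (hY.eval k).aestronglyMeasurable, h0 k, mul_zero, mul_zero]

/-- The mean of `(X + Y)ᵀ M (X + Y)` for independent `X`, `Y` with `Y` centered. -/
lemma integral_quad_add_of_indepFun {X Y : Ω → ι → ℝ} (M : Matrix ι ι ℝ)
    (hX : MemLp X 2 μ) (hY : MemLp Y 2 μ) (hXY : IndepFun X Y μ) (h0 : ∀ k, ∫ ω, Y ω k ∂μ = 0) :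
    ∫ ω, Params.quad M (X ω + Y ω) ∂μ =
      ∫ ω, Params.quad M (X ω) ∂μ + ∫ ω, Params.quad M (Y ω) ∂μ := by
  have e : ∀ ω, Params.quad M (X ω + Y ω) = Params.quad M (X ω) + Params.quad M (Y ω)
      + (X ω ⬝ᵥ M *ᵥ Y ω + X ω ⬝ᵥ Mᵀ *ᵥ Y ω) := fun ω => by
    have : Y ω ⬝ᵥ M *ᵥ X ω = X ω ⬝ᵥ Mᵀ *ᵥ Y ω := by
      rw [dotProduct_mulVec, dotProduct_comm, mulVec_transpose]
    simp only [Params.quad, mulVec_add, add_dotProduct, dotProduct_add, this]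
    ring
  simp only [e]
  rw [integral_add ((integrable_quad M hX).fun_add (integrable_quad M hY))
      ((integrable_dotProduct_mulVec M hX hY).fun_add (integrable_dotProduct_mulVec Mᵀ hX hY)),
    integral_add (integrable_quad M hX) (integrable_quad M hY),
    integral_add (integrable_dotProduct_mulVec M hX hY) (integrable_dotProduct_mulVec Mᵀ hX hY),
    integral_dotProduct_mulVec_of_indepFun M hX hY hXY h0,
    integral_dotProduct_mulVec_of_indepFun Mᵀ hX hY hXY h0, add_zero, add_zero]

/-- `X` is square integrable and centered with covariance matrix `S`. -/
structure HasCov (X : Ω → ι → ℝ) (S : Matrix ι ι ℝ) (μ : Measure Ω) : Prop where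
  memLp : MemLp X 2 μ
  mean : ∀ i, ∫ ω, X ω i ∂μ = 0
  cov : ∀ i j, ∫ ω, X ω i * X ω j ∂μ = S i j

lemma HasCov.mulVec [IsProbabilityMeasure μ] {X : Ω → ι → ℝ} {S : Matrix ι ι ℝ}
    (h : HasCov X S μ) (G : Matrix ι' ι ℝ) :
    HasCov (fun ω => G *ᵥ X ω) (G * S * Gᵀ) μ where
  memLp := memLp_mulVec h.memLp G
  mean i := by
    simp only [Matrix.mulVec, dotProduct]
    rw [integral_finsetSum _ fun k _ =>
      ((h.memLp.eval k).integrable (by norm_num)).const_mul (G i k)]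
    exact Finset.sum_eq_zero fun k _ => by rw [integral_const_mul, h.mean, mul_zero]
  cov i j := by
    have e : ∀ ω, (G *ᵥ X ω) i * (G *ᵥ X ω) j =
        ∑ l, ∑ k, (G i k * G j l) * (X ω k * X ω l) := fun ω => by
      rw [mul_comm]
      simp only [Matrix.mulVec, dotProduct, Finset.sum_mul_sum]
      exact Finset.sum_congr rfl fun l _ => Finset.sum_congr rfl fun k _ => by ring
    simp only [e]
    rw [integral_finsetSum _ fun l _ => integrable_finsetSum _ fun k _ =>
      (integrable_mul_apply h.memLp h.memLp k l).const_mul _]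
    simp only [Matrix.mul_apply, Matrix.transpose_apply, Finset.sum_mul]
    refine Finset.sum_congr rfl fun l _ => ?_
    rw [integral_finsetSum _ fun k _ =>
      (integrable_mul_apply h.memLp h.memLp k l).const_mul _]
    refine Finset.sum_congr rfl fun k _ => ?_
    rw [integral_const_mul, h.cov]
    ring

lemma HasCov.add {X Y : Ω → ι → ℝ} {S S' : Matrix ι ι ℝ} (hX : HasCov X S μ)
    (hY : HasCov Y S' μ) [IsProbabilityMeasure μ] (hXY : IndepFun X Y μ) :
    HasCov (fun ω => X ω + Y ω) (S + S') μ where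
  memLp := hX.memLp.add hY.memLp
  mean i := by
    simp only [Pi.add_apply]
    rw [integral_add ((hX.memLp.eval i).integrable (by norm_num))
      ((hY.memLp.eval i).integrable (by norm_num)), hX.mean, hY.mean, add_zero]
  cov i j := by
    have ind : ∀ i j, ∫ ω, X ω i * Y ω j ∂μ = 0 := fun i j => by
      have hij : IndepFun (fun ω => X ω i) (fun ω => Y ω j) μ :=
        hXY.comp (measurable_pi_apply i) (measurable_pi_apply j)
      rw [hij.integral_fun_mul_eq_mul_integral (hX.memLp.eval i).aestronglyMeasurable
        (hY.memLp.eval j).aestronglyMeasurable, hY.mean, mul_zero]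
    have e : ∀ ω, (X ω + Y ω) i * (X ω + Y ω) j =
        (X ω i * X ω j + Y ω i * Y ω j) + (X ω i * Y ω j + X ω j * Y ω i) := fun ω => by
      simp only [Pi.add_apply]
      ring
    simp only [e]
    rw [integral_add ((integrable_mul_apply hX.memLp hX.memLp i j).fun_add
        (integrable_mul_apply hY.memLp hY.memLp i j))
        ((integrable_mul_apply hX.memLp hY.memLp i j).fun_add
        (integrable_mul_apply hX.memLp hY.memLp j i)),
      integral_add (integrable_mul_apply hX.memLp hX.memLp i j)
        (integrable_mul_apply hY.memLp hY.memLp i j),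
      integral_add (integrable_mul_apply hX.memLp hY.memLp i j)
        (integrable_mul_apply hX.memLp hY.memLp j i), ind, ind, hX.cov, hY.cov, add_zero,
      add_zero, Matrix.add_apply]

/-- If `X` and `Y` are independent and `(X, Y)` is independent of `Z`, then `X` is independent
of `(Z, Y)`. -/
lemma indepFun_prodMk_of_indepFun [IsProbabilityMeasure μ] {α β γ : Type*} [MeasurableSpace α]
    [MeasurableSpace β] [MeasurableSpace γ] {X : Ω → α} {Y : Ω → β} {Z : Ω → γ}
    (hX : Measurable X) (hY : Measurable Y) (hZ : Measurable Z) (hXY : IndepFun X Y μ)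
    (hXYZ : IndepFun (fun ω => (X ω, Y ω)) Z μ) : IndepFun X (fun ω => (Z ω, Y ω)) μ := by
  have := Measure.isProbabilityMeasure_map (μ := μ) hX.aemeasurable
  have := Measure.isProbabilityMeasure_map (μ := μ) hY.aemeasurable
  have := Measure.isProbabilityMeasure_map (μ := μ) hZ.aemeasurable
  have h1 := (indepFun_iff_map_prod_eq_prod_map_map hX.aemeasurable hY.aemeasurable).1 hXY
  have h2 := (indepFun_iff_map_prod_eq_prod_map_map (hX.prodMk hY).aemeasurable
    hZ.aemeasurable).1 hXYZ
  have hYZ : IndepFun Y Z μ := hXYZ.comp measurable_snd measurable_id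
  have h3 := (indepFun_iff_map_prod_eq_prod_map_map hY.aemeasurable hZ.aemeasurable).1 hYZ
  -- The joint law factors as (law X × law Y) × law Z; reassociating gives law X × law (Y, Z).
  have h4 : IndepFun X (fun ω => (Y ω, Z ω)) μ := by
    rw [indepFun_iff_map_prod_eq_prod_map_map hX.aemeasurable (hY.prodMk hZ).aemeasurable, h3,
      ← Measure.prodAssoc_prod, ← h1, ← h2,
      Measure.map_map MeasurableEquiv.prodAssoc.measurable ((hX.prodMk hY).prodMk hZ)]
    rfl
  exact h4.comp measurable_id measurable_swap

lemma HasCov.covariance_eq [IsProbabilityMeasure μ] {X : Ω → ι → ℝ} {S : Matrix ι ι ℝ}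
    (h : HasCov X S μ) (i j : ι) : cov[fun ω => X ω i, fun ω => X ω j; μ] = S i j := by
  rw [covariance_eq_sub (h.memLp.eval i) (h.memLp.eval j), h.mean, zero_mul, sub_zero]
  exact h.cov i j

end Probability

/-! ### Reachability in the graph -/

/-- The edge relation is already transitive: the only two-step paths are 1→3→5 and 2→4→6, and both
have a direct edge. -/
lemma Path.eq_or_edge {i j : Node} (h : Path i j) : i = j ∨ Edge i j := by
  induction h with
  | refl => exact .inl rfl
  | tail _ e ih =>
    rcases ih with rfl | ih
    · exact .inr e
    · cases ih <;> cases e <;> exact .inr (by constructor)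

lemma Path.source_of_target_n2_n4 {i j : Node} (h : Path j i) (hi : i = .n2 ∨ i = .n4) :
    j = .n2 ∨ j = .n4 := by
  rcases h.eq_or_edge with rfl | e
  · exact hi
  · rcases hi with rfl | rfl <;> cases e <;> simp

lemma Path.source_of_target_n1_n3 {i j : Node} (h : Path j i) (hi : i = .n1 ∨ i = .n3) :
    j = .n1 ∨ j = .n3 := by
  rcases h.eq_or_edge with rfl | e
  · exact hi
  · rcases hi with rfl | rfl <;> cases e <;> simp

lemma Path.target_of_source_n3_n5 {i j : Node} (h : Path i j) (hi : i = .n3 ∨ i = .n5) :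
    j = .n3 ∨ j = .n5 := by
  rcases h.eq_or_edge with rfl | e
  · exact hi
  · rcases hi with rfl | rfl <;> cases e <;> simp

lemma Path.target_of_source_n6 {i j : Node} (h : Path i j) (hi : i = .n6) : j = .n6 := by
  rcases h.eq_or_edge with rfl | e
  · exact hi
  · subst hi
    cases e

/-- The sets {2, 4} and {1, 3} are each closed under ancestors, and they are disjoint. -/
lemma not_commonAncestor {i j : Node} (hi : i = .n2 ∨ i = .n4) (hj : j = .n1 ∨ j = .n3) :
    ¬ CommonAncestor i j := by
  rintro ⟨k, hki, hkj⟩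
  rcases hki.source_of_target_n2_n4 hi with rfl | rfl <;>
    simpa using hkj.source_of_target_n1_n3 hj

/-- The sets {6} and {3, 5} are each closed under descendants, and they are disjoint. -/
lemma not_commonDescendant {i j : Node} (hi : i = .n6) (hj : j = .n3 ∨ j = .n5) :
    ¬ CommonDescendant i j := by
  rintro ⟨k, hik, hjk⟩
  have := hik.target_of_source_n6 hi
  subst this
  simpa using hjk.target_of_source_n3_n5 hj

/-! ### The Kalman filter and its zero pattern -/

namespace Params

variable (Θ : Params)

/-- The joint covariance of `(w_t, v_t)`. -/
def noiseCov (t : ℕ) : Matrix (StateIdx (Θ.n (t + 1)) ⊕ Fin (Θ.p t))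
    (StateIdx (Θ.n (t + 1)) ⊕ Fin (Θ.p t)) ℝ :=
  fromBlocks (Θ.W t) (Θ.U t)ᵀ (Θ.U t) (Θ.V t)

/-- The joint covariance of `(A e + w, C e + v)` when `e` has covariance `S`. -/
def jointCov (t : ℕ) (S : Matrix (StateIdx (Θ.n t)) (StateIdx (Θ.n t)) ℝ) :
    Matrix (StateIdx (Θ.n (t + 1)) ⊕ Fin (Θ.p t)) (StateIdx (Θ.n (t + 1)) ⊕ Fin (Θ.p t)) ℝ :=
  lift (fromRows (Θ.A t) (Θ.C t)) (Θ.noiseCov t) S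

/-- The covariance of the one-step prediction error. -/
noncomputable def errCov : ∀ t, Matrix (StateIdx (Θ.n t)) (StateIdx (Θ.n t)) ℝ
  | 0 => Θ.Sinit
  | t + 1 => schur (Θ.jointCov t (errCov t))

/-- The gain of the Kalman filter. -/
noncomputable def filterGain (t : ℕ) : Matrix (StateIdx (Θ.n (t + 1))) (Fin (Θ.p t)) ℝ :=
  (gain (Θ.jointCov t (Θ.errCov t)))ᵀ

/-- The Kalman filter as a function of the available information. -/
noncomputable def filt : ∀ t, Θ.History t → Θ.StateSp t
  | 0, _ => 0
  | t + 1, h =>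
    let z := filt t (fun s => h.1 s.castSucc, fun s => h.2 s.castSucc)
    let u : Θ.InputSp t := h.2 (Fin.last t)
    let y : Θ.OutputSp t := h.1 (Fin.last t)
    Θ.A t *ᵥ z + Θ.B t *ᵥ u - Θ.filterGain t *ᵥ (y - Θ.C t *ᵥ z)

variable {Θ}

lemma errCov_posSemidef (hcov : Θ.CovPosSemidef) : ∀ t ≤ Θ.T, (Θ.errCov t).PosSemidef
  | 0, _ => hcov.2
  | t + 1, ht => schur_posSemidef
      (lift_posSemidef (hcov.1 t ht) (errCov_posSemidef hcov t (Nat.le_of_succ_le ht)))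

lemma jointCov_posSemidef (hcov : Θ.CovPosSemidef) {t : ℕ} (ht : t < Θ.T) :
    (Θ.jointCov t (Θ.errCov t)).PosSemidef :=
  lift_posSemidef (hcov.1 t ht) (errCov_posSemidef hcov t ht.le)

section ZeroPattern

/-- The errors at {2, 4} and at {1, 3} evolve from within their own sets, and the measurement sees
only {1, 3}. Since A2 makes the driving noises uncorrelated, no correlation arises and the
innovation carries no news about nodes 2 and 4. -/
lemma filter_step_zero (hgraph : Θ.ConformsToGraph) (hA2 : Θ.AssumptionA2)
    (hcov : Θ.CovPosSemidef) {t : ℕ} (ht : t < Θ.T)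
    (h : ∀ c d : StateIdx (Θ.n t), (c.1 = .n2 ∨ c.1 = .n4) → (d.1 = .n1 ∨ d.1 = .n3) →
      Θ.errCov t c d = 0) :
    (∀ a b : StateIdx (Θ.n (t + 1)), (a.1 = .n2 ∨ a.1 = .n4) → (b.1 = .n1 ∨ b.1 = .n3) →
      Θ.errCov (t + 1) a b = 0) ∧
    ∀ k (a : StateIdx (Θ.n (t + 1))), (a.1 = .n2 ∨ a.1 = .n4) →
      gain (Θ.jointCov t (Θ.errCov t)) k a = 0 := by
  refine schur_lift_apply_eq_zero (hcov.1 t ht) (errCov_posSemidef hcov t ht.le)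
    (q := fun b => b.1 = .n1 ∨ b.1 = .n3) h ?_ ?_ ?_ ?_ ?_
  · rintro ⟨i, a⟩ ⟨j, c⟩ ha hc
    exact hgraph.A_zero t ht i j (fun hp => hc (hp.source_of_target_n2_n4 ha)) a c
  · rintro ⟨i, a⟩ ⟨j, c⟩ ha hc
    exact hgraph.A_zero t ht i j (fun hp => hc (hp.source_of_target_n1_n3 ha)) a c
  · rintro k ⟨j, c⟩ hc
    exact hgraph.C_zero t ht j (fun hp => hc (hp.source_of_target_n1_n3 (.inr rfl))) k c
  · rintro ⟨i, a⟩ ⟨j, b⟩ ha hb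
    exact ((hA2 i j).1 (not_commonAncestor ha hb)).W_zero t ht a b
  · rintro ⟨i, a⟩ k ha
    exact ((hA2 .n3 i).1 (fun ⟨k, h1, h2⟩ => not_commonAncestor ha (.inr rfl) ⟨k, h2, h1⟩)).U_zero
      rfl t ht k a

lemma errCov_apply_eq_zero (hgraph : Θ.ConformsToGraph) (hA2 : Θ.AssumptionA2)
    (hcov : Θ.CovPosSemidef) : ∀ t ≤ Θ.T, ∀ c d : StateIdx (Θ.n t),
      (c.1 = .n2 ∨ c.1 = .n4) → (d.1 = .n1 ∨ d.1 = .n3) → Θ.errCov t c d = 0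
  | 0, _, ⟨i, a⟩, ⟨j, b⟩, ha, hb => ((hA2 i j).1 (not_commonAncestor ha hb)).Sinit_zero a b
  | t + 1, ht, c, d, hc, hd => (filter_step_zero hgraph hA2 hcov ht
      (errCov_apply_eq_zero hgraph hA2 hcov t (Nat.le_of_succ_le ht))).1 c d hc hd

lemma filterGain_apply_eq_zero (hgraph : Θ.ConformsToGraph) (hA2 : Θ.AssumptionA2)
    (hcov : Θ.CovPosSemidef) {t : ℕ} (ht : t < Θ.T) (a : StateIdx (Θ.n (t + 1)))
    (ha : a.1 = .n2 ∨ a.1 = .n4) (k : Fin (Θ.p t)) : Θ.filterGain t a k = 0 :=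
  (filter_step_zero hgraph hA2 hcov ht
    (errCov_apply_eq_zero hgraph hA2 hcov t ht.le)).2 k a ha

/-- The estimates of the states of nodes 2 and 4 vanish. -/
lemma filt_apply_eq_zero (hgraph : Θ.ConformsToGraph) (hA2 : Θ.AssumptionA2)
    (hcov : Θ.CovPosSemidef) : ∀ t ≤ Θ.T, ∀ (h : Θ.History t) (a : StateIdx (Θ.n t)),
      (a.1 = .n2 ∨ a.1 = .n4) → Θ.filt t h a = 0
  | 0, _, _, _, _ => rfl
  | t + 1, ht, h, ⟨i, a⟩, ha => by
    have ih := filt_apply_eq_zero hgraph hA2 hcov t (Nat.le_of_succ_le ht)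
      (fun s => h.1 s.castSucc, fun s => h.2 s.castSucc)
    have hA : (Θ.A t *ᵥ Θ.filt t (fun s => h.1 s.castSucc, fun s => h.2 s.castSucc)) ⟨i, a⟩ = 0 := by
      refine mulVec_apply_eq_zero fun ⟨j, c⟩ => ?_
      by_cases hc : j = .n2 ∨ j = .n4
      · rw [ih _ hc, mul_zero]
      · rw [hgraph.A_zero t ht i j (fun hp => hc (hp.source_of_target_n2_n4 ha)) a c, zero_mul]
    have hB : ∀ u, (Θ.B t *ᵥ u) ⟨i, a⟩ = 0 := fun u => mulVec_apply_eq_zero fun k => by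
      rw [hgraph.B_zero t ht i (fun hp => ?_) a k, zero_mul]
      simpa using hp.source_of_target_n2_n4 ha
    have hL : ∀ y, (Θ.filterGain t *ᵥ y) ⟨i, a⟩ = 0 := fun y => mulVec_apply_eq_zero fun k => by
      rw [filterGain_apply_eq_zero hgraph hA2 hcov ht _ ha k, zero_mul]
    simp only [filt, Pi.sub_apply, Pi.add_apply]
    rw [hA, hB, hL, add_zero, sub_zero]

end ZeroPattern

/-! ### Prediction error, innovation and measurability of the closed loop -/

variable {Ω : Type*}

/-- The one-step prediction error of the Kalman filter; it does not depend on the strategy. -/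
noncomputable def err (ξ : Θ.Primitives Ω) : ∀ t, Ω → Θ.StateSp t
  | 0, ω => ξ.x0 ω
  | t + 1, ω => (Θ.A t *ᵥ err ξ t ω + ξ.w t ω)
      + Θ.filterGain t *ᵥ (Θ.C t *ᵥ err ξ t ω + ξ.v t ω)

/-- The innovation of the Kalman filter. -/
noncomputable def innov (ξ : Θ.Primitives Ω) (t : ℕ) (ω : Ω) : Θ.OutputSp t :=
  Θ.C t *ᵥ err ξ t ω + ξ.v t ω

lemma info_succ_fst_last (f : Θ.Strategy) (ξ : Θ.Primitives Ω) (t : ℕ) (ω : Ω) :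
    (info f ξ (t + 1) ω).1 (Fin.last t) = output f ξ t ω :=
  Fin.snoc_last (α := fun s : Fin (t + 1) => Θ.OutputSp s) _ _

lemma info_succ_snd_last (f : Θ.Strategy) (ξ : Θ.Primitives Ω) (t : ℕ) (ω : Ω) :
    (info f ξ (t + 1) ω).2 (Fin.last t) = input f ξ t ω :=
  Fin.snoc_last (α := fun s : Fin (t + 1) => Θ.InputSp s) _ _

lemma info_succ_init (f : Θ.Strategy) (ξ : Θ.Primitives Ω) (t : ℕ) (ω : Ω) :
    ((fun s => (info f ξ (t + 1) ω).1 (Fin.castSucc s),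
      fun s => (info f ξ (t + 1) ω).2 (Fin.castSucc s)) : Θ.History t) = info f ξ t ω := by
  refine Prod.ext (funext fun s => ?_) (funext fun s => ?_)
  · exact Fin.snoc_castSucc (α := fun s : Fin (t + 1) => Θ.OutputSp s) _ _ _
  · exact Fin.snoc_castSucc (α := fun s : Fin (t + 1) => Θ.InputSp s) _ _ _

lemma filt_info_succ (f : Θ.Strategy) (ξ : Θ.Primitives Ω) (t : ℕ) (ω : Ω) :
    Θ.filt (t + 1) (info f ξ (t + 1) ω) =
      Θ.A t *ᵥ Θ.filt t (info f ξ t ω) + Θ.B t *ᵥ input f ξ t ω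
        - Θ.filterGain t *ᵥ (output f ξ t ω - Θ.C t *ᵥ Θ.filt t (info f ξ t ω)) := by
  rw [← info_succ_init f ξ t, ← info_succ_fst_last f ξ t, ← info_succ_snd_last f ξ t]
  rfl

lemma state_succ (f : Θ.Strategy) (ξ : Θ.Primitives Ω) (t : ℕ) (ω : Ω) :
    state f ξ (t + 1) ω = Θ.A t *ᵥ state f ξ t ω + Θ.B t *ᵥ input f ξ t ω + ξ.w t ω := rfl

/-- The input enters state and filter through the same term Bu, so the difference obeys a recursion
driven by the noise alone. -/
lemma state_eq_filt_add_err (f : Θ.Strategy) (ξ : Θ.Primitives Ω) (ω : Ω) (t : ℕ) :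
    state f ξ t ω = Θ.filt t (info f ξ t ω) + err ξ t ω := by
  induction t with
  | zero => exact (zero_add _).symm
  | succ t ih =>
    rw [state_succ, filt_info_succ, output, ih, err]
    simp only [mulVec_add, mulVec_sub]
    abel

lemma output_eq (f : Θ.Strategy) (ξ : Θ.Primitives Ω) (t : ℕ) (ω : Ω) :
    output f ξ t ω = Θ.C t *ᵥ Θ.filt t (info f ξ t ω) + innov ξ t ω := by
  rw [output, state_eq_filt_add_err, mulVec_add, add_assoc, innov]

lemma measurable_filt : ∀ t, Measurable (Θ.filt t)
  | 0 => measurable_const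
  | t + 1 => by
    have h1 : Measurable fun h : Θ.History (t + 1) =>
        Θ.filt t (fun s => h.1 s.castSucc, fun s => h.2 s.castSucc) :=
      (measurable_filt t).comp
        ((measurable_pi_lambda _ fun s => (measurable_pi_apply s.castSucc).comp measurable_fst).prodMk
          (measurable_pi_lambda _ fun s => (measurable_pi_apply s.castSucc).comp measurable_snd))
    have hu : Measurable fun h : Θ.History (t + 1) => h.2 (Fin.last t) :=
      (measurable_pi_apply _).comp measurable_snd
    have hy : Measurable fun h : Θ.History (t + 1) => h.1 (Fin.last t) :=
      (measurable_pi_apply _).comp measurable_fst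
    exact (((measurable_mulVec _).comp h1).add ((measurable_mulVec (Θ.B t)).comp hu)).sub
      ((measurable_mulVec _).comp (Measurable.sub hy ((measurable_mulVec (Θ.C t)).comp h1)))

/-- The map which appends a measurement and an input to the information. -/
def extend (t : ℕ) (q : Θ.History t × Θ.OutputSp t × Θ.InputSp t) : Θ.History (t + 1) :=
  (Fin.snoc (α := fun s : Fin (t + 1) => Θ.OutputSp s) q.1.1 q.2.1,
    Fin.snoc (α := fun s : Fin (t + 1) => Θ.InputSp s) q.1.2 q.2.2)

lemma measurable_snoc {t : ℕ} {α : Fin (t + 1) → Type*} [∀ s, MeasurableSpace (α s)] :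
    Measurable fun q : (∀ s : Fin t, α s.castSucc) × α (Fin.last t) => Fin.snoc (α := α) q.1 q.2 := by
  refine measurable_pi_lambda _ fun s => ?_
  refine Fin.lastCases ?_ (fun s => ?_) s
  · simpa only [Fin.snoc_last] using measurable_snd
  · simp only [Fin.snoc_castSucc]
    exact (measurable_pi_apply s).comp measurable_fst

lemma measurable_extend (t : ℕ) : Measurable (extend (Θ := Θ) t) := by
  refine Measurable.prodMk ?_ ?_
  · exact (measurable_snoc (α := fun s : Fin (t + 1) => Θ.OutputSp s)).comp
      (measurable_fst.fst.prodMk measurable_snd.fst)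
  · exact (measurable_snoc (α := fun s : Fin (t + 1) => Θ.InputSp s)).comp
      (measurable_fst.snd.prodMk measurable_snd.snd)

lemma info_succ (f : Θ.Strategy) (ξ : Θ.Primitives Ω) (t : ℕ) (ω : Ω) :
    info f ξ (t + 1) ω = extend t (info f ξ t ω, output f ξ t ω, input f ξ t ω) := rfl

/-- The primitive random vectors which have been realized before time `t` are measurable. -/
structure Primitives.MeasurableBefore [MeasurableSpace Ω] (ξ : Θ.Primitives Ω) (t : ℕ) :
    Prop where
  x0 : Measurable ξ.x0
  w : ∀ s < t, Measurable (ξ.w s)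
  v : ∀ s < t, Measurable (ξ.v s)

lemma Primitives.MeasurableBefore.prev [MeasurableSpace Ω] {ξ : Θ.Primitives Ω} {t : ℕ}
    (h : ξ.MeasurableBefore (t + 1)) : ξ.MeasurableBefore t :=
  ⟨h.x0, fun s hs => h.w s (by omega), fun s hs => h.v s (by omega)⟩

/-- The σ-algebra on Ω is left free: the ambient one gives measurability, and `Primitives.past`
gives dependence on the past noise only. -/
lemma measurable_err [MeasurableSpace Ω] {ξ : Θ.Primitives Ω} :
    ∀ {t}, ξ.MeasurableBefore t → Measurable (err ξ t)
  | 0, h => h.x0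
  | t + 1, h => by
    have he := measurable_err h.prev
    exact (((measurable_mulVec _).comp he).add (h.w t (by omega))).add
      ((measurable_mulVec _).comp (((measurable_mulVec _).comp he).add (h.v t (by omega))))

lemma measurable_traj [MeasurableSpace Ω] {ξ : Θ.Primitives Ω} (f : Θ.Strategy) :
    ∀ {t}, ξ.MeasurableBefore t → Measurable fun ω => (state f ξ t ω, info f ξ t ω)
  | 0, h => h.x0.prodMk measurable_const
  | t + 1, h => by
    have ih := measurable_traj f h.prev
    have hu : Measurable (input f ξ t) := (f.measurable_act t).comp ih.snd
    have hy : Measurable (output f ξ t) :=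
      ((measurable_mulVec _).comp ih.fst).add (h.v t (by omega))
    exact ((((measurable_mulVec _).comp ih.fst).add ((measurable_mulVec _).comp hu)).add
      (h.w t (by omega))).prodMk ((measurable_extend t).comp (ih.snd.prodMk (hy.prodMk hu)))

end Params

/-! ### Independence of error and information; the conditional mean -/

namespace Params

variable {Θ : Params} {Ω : Type*}

/-- The σ-algebra generated by the `k`-th primitive random vector. -/
@[reducible]
def Primitives.sigma (ξ : Θ.Primitives Ω) (k : Option (Fin Θ.T)) : MeasurableSpace Ω :=
  k.elim (MeasurableSpace.comap ξ.x0 inferInstance)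
    (fun t => MeasurableSpace.comap (fun ω => (ξ.w t ω, ξ.v t ω)) inferInstance)

/-- The σ-algebra generated by the primitive random vectors realized before time `t`. -/
@[reducible]
def Primitives.past (ξ : Θ.Primitives Ω) (t : ℕ) : MeasurableSpace Ω :=
  ⨆ k ∈ {k : Option (Fin Θ.T) | ∀ s ∈ k, s.val < t}, ξ.sigma k

lemma Primitives.measurableBefore_past (ξ : Θ.Primitives Ω) {t : ℕ} (ht : t ≤ Θ.T) :
    @Primitives.MeasurableBefore Θ Ω (ξ.past t) ξ t := by
  have hs : ∀ s, s < t → ∃ hT : s < Θ.T, ξ.sigma (some ⟨s, hT⟩) ≤ ξ.past t := fun s hs =>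
    ⟨by omega, le_iSup₂_of_le (some ⟨s, by omega⟩) (by simpa using hs) le_rfl⟩
  -- The index `none` of the initial state satisfies the time condition vacuously, so it belongs to
  -- every past.
  have h0 : ξ.sigma none ≤ ξ.past t := le_iSup₂_of_le none (by simp) le_rfl
  refine @Primitives.MeasurableBefore.mk Θ Ω (ξ.past t) ξ t ?_ ?_ ?_
  · exact Measurable.mono (comap_measurable ξ.x0) h0 le_rfl
  · intro s hst
    obtain ⟨hT, hle⟩ := hs s hst
    exact Measurable.mono (measurable_fst.comp
      (comap_measurable fun ω => (ξ.w s ω, ξ.v s ω))) hle le_rfl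
  · intro s hst
    obtain ⟨hT, hle⟩ := hs s hst
    exact Measurable.mono (measurable_snd.comp
      (comap_measurable fun ω => (ξ.w s ω, ξ.v s ω))) hle le_rfl

lemma joint_eq (ξ : Θ.Primitives Ω) (t : ℕ) (ω : Ω) :
    fromRows (Θ.A t) (Θ.C t) *ᵥ err ξ t ω + Sum.elim (ξ.w t ω) (ξ.v t ω) =
      Sum.elim (Θ.A t *ᵥ err ξ t ω + ξ.w t ω) (innov ξ t ω) := by
  rw [fromRows_mulVec, ← Sum.elim_add_add, innov]

lemma err_succ (ξ : Θ.Primitives Ω) (t : ℕ) (ω : Ω) :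
    err ξ (t + 1) ω = (Θ.A t *ᵥ err ξ t ω + ξ.w t ω) + Θ.filterGain t *ᵥ innov ξ t ω := rfl

namespace Primitives.HasLQGLaw

variable [MeasurableSpace Ω] {μ : Measure Ω} {ξ : Θ.Primitives Ω}

lemma measurableBefore (h : ξ.HasLQGLaw μ) {t : ℕ} (ht : t ≤ Θ.T) : ξ.MeasurableBefore t :=
  ⟨h.measurable_x0, fun s hs => h.measurable_w s (by omega),
    fun s hs => h.measurable_v s (by omega)⟩

lemma sigma_le (h : ξ.HasLQGLaw μ) (k : Option (Fin Θ.T)) : ξ.sigma k ≤ ‹MeasurableSpace Ω› := by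
  cases k with
  | none => exact h.measurable_x0.comap_le
  | some t => exact ((h.measurable_w t t.2).prodMk (h.measurable_v t t.2)).comap_le

/-- What is determined before time `t` is independent of the noise at time `t`. -/
lemma indepFun_noise (h : ξ.HasLQGLaw μ) {t : ℕ} (ht : t < Θ.T) {α : Type*} [MeasurableSpace α]
    {X : Ω → α} (hX : Measurable[ξ.past t] X) : IndepFun X (fun ω => (ξ.w t ω, ξ.v t ω)) μ := by
  have hind := indep_iSup_of_disjoint h.sigma_le h.indep
    (S := {k : Option (Fin Θ.T) | ∀ s ∈ k, s.val < t}) (T := {some ⟨t, ht⟩})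
    (by simp [Set.disjoint_singleton_right])
  rw [IndepFun_iff_Indep]
  refine indep_of_indep_of_le_left (indep_of_indep_of_le_right hind ?_) hX.comap_le
  exact le_iSup₂_of_le (some ⟨t, ht⟩) rfl le_rfl

lemma measurable_noise (h : ξ.HasLQGLaw μ) {t : ℕ} (ht : t < Θ.T) :
    Measurable (fun ω => (ξ.w t ω, ξ.v t ω)) :=
  (h.measurable_w t ht).prodMk (h.measurable_v t ht)

lemma measurable_err (h : ξ.HasLQGLaw μ) {t : ℕ} (ht : t ≤ Θ.T) : Measurable (err ξ t) :=
  Params.measurable_err (h.measurableBefore ht)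

lemma measurable_traj (h : ξ.HasLQGLaw μ) (f : Θ.Strategy) {t : ℕ} (ht : t ≤ Θ.T) :
    Measurable fun ω => (state f ξ t ω, info f ξ t ω) :=
  Params.measurable_traj f (h.measurableBefore ht)

lemma measurable_info (h : ξ.HasLQGLaw μ) (f : Θ.Strategy) {t : ℕ} (ht : t ≤ Θ.T) :
    Measurable (info f ξ t) :=
  (h.measurable_traj f ht).snd

lemma hasCov_x0 (h : ξ.HasLQGLaw μ) : HasCov ξ.x0 Θ.Sinit μ :=
  ⟨h.gaussian_x0.memLp_two, h.mean_x0, h.cov_x0⟩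

lemma memLp_w (h : ξ.HasLQGLaw μ) {t : ℕ} (ht : t < Θ.T) : MemLp (ξ.w t) 2 μ :=
  (h.gaussian_wv t ht).fst.memLp_two

lemma hasCov_noise (h : ξ.HasLQGLaw μ) {t : ℕ} (ht : t < Θ.T) :
    HasCov (fun ω => Sum.elim (ξ.w t ω) (ξ.v t ω)) (Θ.noiseCov t) μ where
  memLp := by
    refine MemLp.of_eval fun i => ?_
    cases i with
    | inl i => exact (h.gaussian_wv t ht).fst.memLp_two.eval i
    | inr i => exact (h.gaussian_wv t ht).snd.memLp_two.eval i
  mean i := by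
    cases i with
    | inl i => exact h.mean_w t ht i
    | inr i => exact h.mean_v t ht i
  cov i j := by
    cases i with
    | inl i =>
      cases j with
      | inl j => exact h.cov_w t ht i j
      | inr j =>
        simp only [Sum.elim_inl, Sum.elim_inr, mul_comm (ξ.w t _ i)]
        exact h.cov_vw t ht j i
    | inr i =>
      cases j with
      | inl j => exact h.cov_vw t ht i j
      | inr j => exact h.cov_v t ht i j

variable [IsProbabilityMeasure μ]

/-- The one-step prediction error and the innovation before decorrelation. -/
lemma hasCov_joint (h : ξ.HasLQGLaw μ) {t : ℕ} (ht : t < Θ.T)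
    (he : HasCov (err ξ t) (Θ.errCov t) μ) :
    HasCov (fun ω => fromRows (Θ.A t) (Θ.C t) *ᵥ err ξ t ω + Sum.elim (ξ.w t ω) (ξ.v t ω))
      (Θ.jointCov t (Θ.errCov t)) μ := by
  have hind : IndepFun (err ξ t) (fun ω => (ξ.w t ω, ξ.v t ω)) μ :=
    h.indepFun_noise ht (@Params.measurable_err Θ Ω (ξ.past t) ξ t (ξ.measurableBefore_past ht.le))
  refine (he.mulVec _).add (h.hasCov_noise ht) ?_
  refine hind.comp (measurable_mulVec (fromRows (Θ.A t) (Θ.C t)))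
    (ψ := fun q i => Sum.elim q.1 q.2 i) ?_
  refine measurable_pi_lambda _ fun i => ?_
  cases i with
  | inl i => exact (measurable_pi_apply i).comp measurable_fst
  | inr i => exact (measurable_pi_apply i).comp measurable_snd

lemma hasCov_err (h : ξ.HasLQGLaw μ) : ∀ t ≤ Θ.T, HasCov (err ξ t) (Θ.errCov t) μ
  | 0, _ => h.hasCov_x0
  | t + 1, ht => by
    have hJ := (h.hasCov_joint ht (h.hasCov_err t (Nat.le_of_succ_le ht))).mulVec
      (fromCols 1 (Θ.filterGain t))
    have e : ∀ ω, fromCols 1 (Θ.filterGain t) *ᵥ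
        (fromRows (Θ.A t) (Θ.C t) *ᵥ err ξ t ω + Sum.elim (ξ.w t ω) (ξ.v t ω)) =
          err ξ (t + 1) ω := fun ω => by
      rw [joint_eq, fromCols_mulVec_sumElim, one_mulVec, err_succ]
    simp only [e] at hJ
    -- `schur` is defined as exactly this congruence, so the covariance recursion holds
    -- definitionally and needs no semidefiniteness.
    exact hJ

/-- The pair (new error, innovation) is the image of (Ae + w, Ce + v) under the block-triangular map
that decorrelates its covariance; this is the purpose of the filter gain. -/
lemma covariance_err_innov (h : ξ.HasLQGLaw μ) (hcov : Θ.CovPosSemidef) {t : ℕ} (ht : t < Θ.T)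
    (i : StateIdx (Θ.n (t + 1))) (k : Fin (Θ.p t)) :
    cov[fun ω => err ξ (t + 1) ω i, fun ω => innov ξ t ω k; μ] = 0 := by
  have hJ := (h.hasCov_joint ht (h.hasCov_err t ht.le)).mulVec
    (decorrelate (Θ.jointCov t (Θ.errCov t)))
  have e : ∀ ω, decorrelate (Θ.jointCov t (Θ.errCov t)) *ᵥ
      (fromRows (Θ.A t) (Θ.C t) *ᵥ err ξ t ω + Sum.elim (ξ.w t ω) (ξ.v t ω)) =
        Sum.elim (err ξ (t + 1) ω) (innov ξ t ω) := fun ω => by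
    rw [joint_eq, decorrelate, fromBlocks_mulVec]
    simp only [Sum.elim_comp_inl, Sum.elim_comp_inr, one_mulVec, zero_mulVec, zero_add]
    rfl
  simp only [e] at hJ
  have := hJ.covariance_eq (.inl i) (.inr k)
  rw [decorrelate_apply (jointCov_posSemidef hcov ht)] at this
  exact this

/-- The linear map which sends `(e_t, (w_t, v_t))` to `e_{t+1}` and the innovation. -/
noncomputable def errStep (Θ : Params) (t : ℕ) :
    (Θ.StateSp t × Θ.StateSp (t + 1) × Θ.OutputSp t) →L[ℝ] Θ.StateSp (t + 1) × Θ.OutputSp t :=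
  LinearMap.toContinuousLinearMap
    { toFun := fun q => ((Θ.A t *ᵥ q.1 + q.2.1) + Θ.filterGain t *ᵥ (Θ.C t *ᵥ q.1 + q.2.2),
        Θ.C t *ᵥ q.1 + q.2.2)
      map_add' := fun q r => by
        ext i <;> simp [mulVec_add] <;> ring
      map_smul' := fun c q => by
        ext i <;> simp [mulVec_add, mulVec_smul] }

omit [IsProbabilityMeasure μ] in
lemma gaussian_err_innov (h : ξ.HasLQGLaw μ) {t : ℕ} (ht : t < Θ.T)
    (he : HasGaussianLaw (err ξ t) μ) :
    HasGaussianLaw (fun ω => (err ξ (t + 1) ω, innov ξ t ω)) μ := by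
  have hind : IndepFun (err ξ t) (fun ω => (ξ.w t ω, ξ.v t ω)) μ :=
    h.indepFun_noise ht (@Params.measurable_err Θ Ω (ξ.past t) ξ t (ξ.measurableBefore_past ht.le))
  exact (hind.hasGaussianLaw he (h.gaussian_wv t ht)).map_fun (errStep Θ t)

omit [IsProbabilityMeasure μ] in
lemma gaussian_err (h : ξ.HasLQGLaw μ) : ∀ t ≤ Θ.T, HasGaussianLaw (err ξ t) μ
  | 0, _ => h.gaussian_x0
  | t + 1, ht => (h.gaussian_err_innov ht (h.gaussian_err t (Nat.le_of_succ_le ht))).fst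

lemma indepFun_err_innov (h : ξ.HasLQGLaw μ) (hcov : Θ.CovPosSemidef) {t : ℕ} (ht : t < Θ.T) :
    IndepFun (err ξ (t + 1)) (innov ξ t) μ :=
  HasGaussianLaw.indepFun_of_covariance_eval (X := fun i ω => err ξ (t + 1) ω i)
    (Y := fun k ω => innov ξ t ω k) (h.gaussian_err_innov ht (h.gaussian_err t ht.le))
    (h.covariance_err_innov hcov ht)

/-- The prediction error is independent of the available information. -/
lemma indepFun_err_info (h : ξ.HasLQGLaw μ) (hcov : Θ.CovPosSemidef) (f : Θ.Strategy) :
    ∀ t ≤ Θ.T, IndepFun (err ξ t) (info f ξ t) μ := by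
  intro t
  induction t with
  | zero =>
    intro _
    have : info f ξ 0 = fun _ => (fun s => s.elim0, fun s => s.elim0) := rfl
    rw [this]
    exact indepFun_const_right _ _
  | succ t ih =>
    intro ht
    have ht' : t ≤ Θ.T := Nat.le_of_succ_le ht
    replace ih := ih ht'
    have hei : Measurable[ξ.past t] fun ω => (err ξ t ω, info f ξ t ω) :=
      Measurable.prodMk (@Params.measurable_err Θ Ω (ξ.past t) ξ t (ξ.measurableBefore_past ht'))
        (@Params.measurable_traj Θ Ω (ξ.past t) ξ f t (ξ.measurableBefore_past ht')).snd
    have hn := h.indepFun_noise ht hei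
    -- The information is independent of the error by induction, and both together are independent
    -- of the fresh noise.
    have hie : IndepFun (info f ξ t) (fun ω => (err ξ t ω, (ξ.w t ω, ξ.v t ω))) μ := by
      have h1 : IndepFun (fun ω => (info f ξ t ω, err ξ t ω)) (fun ω => (ξ.w t ω, ξ.v t ω)) μ :=
        hn.comp measurable_swap measurable_id
      have h2 := indepFun_prodMk_of_indepFun (h.measurable_noise ht) (h.measurable_err ht')
        (h.measurable_info f ht') (h1.symm.comp measurable_id measurable_snd)
      have h3 : IndepFun (fun ω => (err ξ t ω, (ξ.w t ω, ξ.v t ω))) (info f ξ t) μ := by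
        refine (indepFun_prodMk_of_indepFun (h.measurable_info f ht') (h.measurable_err ht')
          (h.measurable_noise ht) ih.symm h1).symm.comp measurable_swap measurable_id
      exact h3.symm
    have hstep : IndepFun (fun ω => (err ξ (t + 1) ω, innov ξ t ω)) (info f ξ t) μ :=
      hie.symm.comp (errStep Θ t).continuous.measurable measurable_id
    have hν : Measurable (innov ξ t) :=
      ((measurable_mulVec _).comp (h.measurable_err ht')).add (h.measurable_v t ht)
    -- The new error is independent of the innovation, and the pair is independent of the old
    -- information; hence the new error is independent of old information and innovation jointly.
    have hfin := indepFun_prodMk_of_indepFun (h.measurable_err ht) hν (h.measurable_info f ht')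
      (h.indepFun_err_innov hcov ht) hstep
    have hext : Measurable fun q : Θ.History t × Θ.OutputSp t =>
        extend t (q.1, Θ.C t *ᵥ Θ.filt t q.1 + q.2, f.act t q.1) :=
      (measurable_extend t).comp (measurable_fst.prodMk ((((measurable_mulVec _).comp
        ((measurable_filt t).comp measurable_fst)).add measurable_snd).prodMk
          ((f.measurable_act t).comp measurable_fst)))
    -- The new measurement is its prediction plus the innovation, and the new input is a function of
    -- the old information. This works for arbitrary measurable, possibly nonlinear, strategies.
    have e : info f ξ (t + 1) = (fun q : Θ.History t × Θ.OutputSp t =>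
        extend t (q.1, Θ.C t *ᵥ Θ.filt t q.1 + q.2, f.act t q.1)) ∘
          fun ω => (info f ξ t ω, innov ξ t ω) := by
      funext ω
      rw [Function.comp_apply, info_succ f ξ t ω, output_eq f ξ t ω]
      rfl
    rw [e]
    exact hfin.comp measurable_id hext

omit [IsProbabilityMeasure μ] in
-- Only inputs before time t are assumed square integrable, so the bound can be used while
-- admissibility of a strategy is still being proved.
lemma memLp_state (h : ξ.HasLQGLaw μ) (f : Θ.Strategy) :
    ∀ t ≤ Θ.T, (∀ s < t, MemLp (input f ξ s) 2 μ) → MemLp (state f ξ t) 2 μ := by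
  intro t
  induction t with
  | zero => exact fun _ _ => h.hasCov_x0.memLp
  | succ t ih =>
    intro ht hu
    replace ih := ih (Nat.le_of_succ_le ht) fun s hs => hu s (by omega)
    have hA : MemLp (fun ω => Θ.A t *ᵥ state f ξ t ω) 2 μ := memLp_mulVec ih _
    have hB : MemLp (fun ω => Θ.B t *ᵥ input f ξ t ω) 2 μ :=
      memLp_mulVec (hu t (Nat.lt_succ_self t)) _
    have e : state f ξ (t + 1) = (fun ω => Θ.A t *ᵥ state f ξ t ω) +
        (fun ω => Θ.B t *ᵥ input f ξ t ω) + ξ.w t := funext fun ω => state_succ f ξ t ω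
    rw [e]
    exact (hA.add hB).add (h.memLp_w ht)

lemma memLp_filt (h : ξ.HasLQGLaw μ) {f : Θ.Strategy} {t : ℕ} (ht : t ≤ Θ.T)
    (hx : MemLp (state f ξ t) 2 μ) : MemLp (fun ω => Θ.filt t (info f ξ t ω)) 2 μ := by
  have e : (fun ω => Θ.filt t (info f ξ t ω)) = fun ω => state f ξ t ω - err ξ t ω := by
    funext ω
    rw [state_eq_filt_add_err, add_sub_cancel_right]
  rw [e]
  exact hx.sub (h.hasCov_err t ht).memLp

/-- The Kalman filter computes the conditional expectation of the state. -/
lemma estimate_ae_eq (h : ξ.HasLQGLaw μ) (hcov : Θ.CovPosSemidef) {f : Θ.Strategy}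
    (hf : Admissible μ ξ f) (s : Finset Node) {t : ℕ} (ht : t ≤ Θ.T) :
    estimate μ f ξ s t =ᵐ[μ] fun ω a => Θ.filt t (info f ξ t ω) a.1 := by
  have hx := h.memLp_state f t ht fun s hs => hf s (by omega)
  have hle : infoSigma f ξ t ≤ ‹MeasurableSpace Ω› := (h.measurable_info f ht).comap_le
  have hr : Measurable fun (x : Θ.StateSp t) (a : SubIdx (Θ.n t) s) => x a.1 :=
    measurable_pi_lambda _ fun a => measurable_pi_apply a.1
  have hint : ∀ {X : Ω → Θ.StateSp t}, MemLp X 2 μ →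
      Integrable (fun ω (a : SubIdx (Θ.n t) s) => X ω a.1) μ := fun hX =>
    Integrable.of_eval fun a => (hX.eval a.1).integrable (by norm_num)
  have hz := hint (h.memLp_filt ht hx)
  have he := hint (h.hasCov_err t ht).memLp
  have e : (fun ω (a : SubIdx (Θ.n t) s) => state f ξ t ω a.1) =
      (fun ω (a : SubIdx (Θ.n t) s) => Θ.filt t (info f ξ t ω) a.1) +
        fun ω (a : SubIdx (Θ.n t) s) => err ξ t ω a.1 := by
    funext ω a
    rw [state_eq_filt_add_err]
    rfl
  have hzm : StronglyMeasurable[infoSigma f ξ t]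
      fun ω (a : SubIdx (Θ.n t) s) => Θ.filt t (info f ξ t ω) a.1 :=
    (hr.comp ((measurable_filt t).comp (comap_measurable (info f ξ t)))).stronglyMeasurable
  have hind : μ[fun ω (a : SubIdx (Θ.n t) s) => err ξ t ω a.1 | infoSigma f ξ t] =ᵐ[μ]
      fun _ => ∫ ω, (fun a : SubIdx (Θ.n t) s => err ξ t ω a.1) ∂μ :=
    condExp_indep_eq (h.measurable_err ht).comap_le hle
      (hr.comp (comap_measurable (err ξ t))).stronglyMeasurable
      ((IndepFun_iff_Indep _ _ _).1 (h.indepFun_err_info hcov f t ht))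
  have hmean : ∫ ω, (fun a : SubIdx (Θ.n t) s => err ξ t ω a.1) ∂μ = 0 := by
    funext a
    rw [eval_integral fun a => he.eval a]
    exact (h.hasCov_err t ht).mean a.1
  rw [estimate, e]
  filter_upwards [condExp_add hz he (infoSigma f ξ t), hind] with ω h1 h2
  rw [h1, Pi.add_apply, h2, hmean, condExp_of_stronglyMeasurable hle hzm hz, add_zero]

end Primitives.HasLQGLaw

end Params

/-! ### The control Riccati recursion and its zero pattern -/

namespace Params

variable (Θ : Params)

/-- The weight of the stage cost. -/
def costWeight (t : ℕ) : Matrix (StateIdx (Θ.n t) ⊕ Fin (Θ.m t)) (StateIdx (Θ.n t) ⊕ Fin (Θ.m t)) ℝ :=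
  fromBlocks (Θ.Q t) (Θ.S t) (Θ.S t)ᵀ (Θ.R t)

/-- The weight of the stage cost plus the cost-to-go `P` of the next state. -/
def jointWeight (t : ℕ) (P : Matrix (StateIdx (Θ.n (t + 1))) (StateIdx (Θ.n (t + 1))) ℝ) :
    Matrix (StateIdx (Θ.n t) ⊕ Fin (Θ.m t)) (StateIdx (Θ.n t) ⊕ Fin (Θ.m t)) ℝ :=
  lift (fromCols (Θ.A t) (Θ.B t))ᵀ (Θ.costWeight t) P

/-- `P` solves the backward Riccati recursion of the control problem. -/
structure IsCostToGo (P : ∀ t, Matrix (StateIdx (Θ.n t)) (StateIdx (Θ.n t)) ℝ) : Prop where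
  final : P Θ.T = Θ.Pfinal
  step : ∀ t < Θ.T, P t = schur (Θ.jointWeight t (P (t + 1)))

lemma exists_isCostToGo : ∃ P, Θ.IsCostToGo P := by
  obtain ⟨P, hP, hstep⟩ := exists_backward_recursion
    (X := fun t => Matrix (StateIdx (Θ.n t)) (StateIdx (Θ.n t)) ℝ)
    (fun t P => schur (Θ.jointWeight t P)) Θ.T Θ.Pfinal
  exact ⟨P, hP, hstep⟩

variable {Θ} {P : ∀ t, Matrix (StateIdx (Θ.n t)) (StateIdx (Θ.n t)) ℝ}

lemma jointWeight_toBlocks₂₂ (t : ℕ)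
    (P : Matrix (StateIdx (Θ.n (t + 1))) (StateIdx (Θ.n (t + 1))) ℝ) :
    (Θ.jointWeight t P).toBlocks₂₂ = (Θ.B t)ᵀ * P * Θ.B t + Θ.R t := by
  rw [jointWeight, lift, transpose_transpose, transpose_fromCols, costWeight, fromRows_mul,
    fromRows_mul_fromCols, fromBlocks_add, toBlocks_fromBlocks₂₂]

namespace IsCostToGo

lemma posSemidef (hP : Θ.IsCostToGo P) (hcost : Θ.CostPosSemidef) {t : ℕ} (ht : t ≤ Θ.T) :
    (P t).PosSemidef := by
  induction ht using Nat.decreasingInduction with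
  | self => exact hP.final ▸ hcost.2
  | of_succ t ht ih => exact hP.step t ht ▸ schur_posSemidef (lift_posSemidef (hcost.1 t ht) ih)

lemma jointWeight_posSemidef (hP : Θ.IsCostToGo P) (hcost : Θ.CostPosSemidef) {t : ℕ}
    (ht : t < Θ.T) : (Θ.jointWeight t (P (t + 1))).PosSemidef :=
  lift_posSemidef (hcost.1 t ht) (hP.posSemidef hcost ht)

lemma toBlocks₂₂_posDef (hP : Θ.IsCostToGo P) (hcost : Θ.CostPosSemidef) {t : ℕ}
    (ht : t < Θ.T) (hR : (Θ.R t).PosDef) : (Θ.jointWeight t (P (t + 1))).toBlocks₂₂.PosDef := by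
  rw [jointWeight_toBlocks₂₂]
  have := (hP.posSemidef hcost ht).conjTranspose_mul_mul_same (Θ.B t)
  rw [conjTranspose_eq_transpose_of_trivial] at this
  exact hR.posSemidef_add this

section ZeroPattern

/-- The dual of `filter_step_zero`, with descendants in place of ancestors: node 6 influences only
itself, while nodes 3, 5 and the input influence only {3, 5}, and A2 decouples the costs of the two
sets. -/
lemma step_zero (hP : Θ.IsCostToGo P) (hgraph : Θ.ConformsToGraph) (hA2 : Θ.AssumptionA2)
    (hcost : Θ.CostPosSemidef) {t : ℕ} (ht : t < Θ.T)
    (h : ∀ c d : StateIdx (Θ.n (t + 1)), c.1 = .n6 → (d.1 = .n3 ∨ d.1 = .n5) →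
      P (t + 1) c d = 0) :
    (∀ a b : StateIdx (Θ.n t), a.1 = .n6 → (b.1 = .n3 ∨ b.1 = .n5) → P t a b = 0) ∧
    ∀ k (a : StateIdx (Θ.n t)), a.1 = .n6 → gain (Θ.jointWeight t (P (t + 1))) k a = 0 := by
  rw [hP.step t ht]
  refine schur_lift_apply_eq_zero (hcost.1 t ht) (hP.posSemidef hcost ht)
    (q := fun b => b.1 = .n3 ∨ b.1 = .n5) h ?_ ?_ ?_ ?_ ?_
  · rintro ⟨i, a⟩ ⟨j, c⟩ ha hc
    exact hgraph.A_zero t ht j i (fun hp => hc (hp.target_of_source_n6 ha)) c a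
  · rintro ⟨i, a⟩ ⟨j, c⟩ ha hc
    exact hgraph.A_zero t ht j i (fun hp => hc (hp.target_of_source_n3_n5 ha)) c a
  · rintro k ⟨j, c⟩ hc
    exact hgraph.B_zero t ht j (fun hp => hc (hp.target_of_source_n3_n5 (.inl rfl))) c k
  · rintro ⟨i, a⟩ ⟨j, b⟩ ha hb
    exact ((hA2 i j).2 (not_commonDescendant ha hb)).Q_zero t ht a b
  · rintro ⟨i, a⟩ k ha
    exact ((hA2 i .n3).2 (not_commonDescendant ha (.inl rfl))).S_zero rfl t ht a k

lemma apply_eq_zero (hP : Θ.IsCostToGo P) (hgraph : Θ.ConformsToGraph) (hA2 : Θ.AssumptionA2)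
    (hcost : Θ.CostPosSemidef) {t : ℕ} (ht : t ≤ Θ.T) :
    ∀ c d : StateIdx (Θ.n t), c.1 = .n6 → (d.1 = .n3 ∨ d.1 = .n5) → P t c d = 0 := by
  induction ht using Nat.decreasingInduction with
  | self =>
    rintro ⟨i, a⟩ ⟨j, b⟩ ha hb
    rw [hP.final]
    exact ((hA2 i j).2 (not_commonDescendant ha hb)).P_zero a b
  | of_succ t ht ih => exact (hP.step_zero hgraph hA2 hcost ht ih).1

lemma gain_apply_eq_zero (hP : Θ.IsCostToGo P) (hgraph : Θ.ConformsToGraph)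
    (hA2 : Θ.AssumptionA2) (hcost : Θ.CostPosSemidef) {t : ℕ} (ht : t < Θ.T) (k : Fin (Θ.m t))
    (a : StateIdx (Θ.n t)) (ha : a.1 = .n6) : gain (Θ.jointWeight t (P (t + 1))) k a = 0 :=
  (hP.step_zero hgraph hA2 hcost ht (hP.apply_eq_zero hgraph hA2 hcost ht)).2 k a ha

end ZeroPattern

end IsCostToGo

/-! ### Decomposition of the cost and optimality -/

variable {Ω : Type*} [MeasurableSpace Ω] {μ : Measure Ω} {ξ : Θ.Primitives Ω}

/-- The deviation of the input from the certainty equivalent control law. -/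
noncomputable def deviation (P : ∀ t, Matrix (StateIdx (Θ.n t)) (StateIdx (Θ.n t)) ℝ)
    (f : Θ.Strategy) (ξ : Θ.Primitives Ω) (t : ℕ) (ω : Ω) : Θ.InputSp t :=
  input f ξ t ω - gain (Θ.jointWeight t (P (t + 1))) *ᵥ Θ.filt t (info f ξ t ω)

/-- The expected cost that a deviation from the certainty equivalent control law adds. -/
noncomputable def excess (μ : Measure Ω)
    (P : ∀ t, Matrix (StateIdx (Θ.n t)) (StateIdx (Θ.n t)) ℝ)
    (f : Θ.Strategy) (ξ : Θ.Primitives Ω) (t : ℕ) : ℝ :=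
  ∫ ω, quad (Θ.jointWeight t (P (t + 1))).toBlocks₂₂ (deviation P f ξ t ω) ∂μ

/-- The part of the expected cost which no strategy can influence. -/
noncomputable def unavoidableCost (μ : Measure Ω)
    (P : ∀ t, Matrix (StateIdx (Θ.n t)) (StateIdx (Θ.n t)) ℝ) (ξ : Θ.Primitives Ω) (t : ℕ) : ℝ :=
  ∫ ω, quad (Θ.jointWeight t (P (t + 1))).toBlocks₂₂
      (-(gain (Θ.jointWeight t (P (t + 1))) *ᵥ err ξ t ω)) ∂μ
    + ∫ ω, quad (P (t + 1)) (ξ.w t ω) ∂μ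

lemma memLp_sumElim {ι κ : Type*} [Fintype ι] [Fintype κ] {X : Ω → ι → ℝ} {Y : Ω → κ → ℝ}
    (hX : MemLp X 2 μ) (hY : MemLp Y 2 μ) : MemLp (fun ω => Sum.elim (X ω) (Y ω)) 2 μ := by
  refine MemLp.of_eval fun i => ?_
  cases i with
  | inl i => exact hX.eval i
  | inr i => exact hY.eval i

variable [IsProbabilityMeasure μ]

/-- The expected cost-to-go over one time step. -/
lemma IsCostToGo.integral_step (hP : Θ.IsCostToGo P) (hcost : Θ.CostPosSemidef)
    (hcov : Θ.CovPosSemidef) (h : ξ.HasLQGLaw μ) {f : Θ.Strategy} (hf : Admissible μ ξ f)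
    {t : ℕ} (ht : t < Θ.T) :
    ∫ ω, quad (Θ.costWeight t) (Sum.elim (state f ξ t ω) (input f ξ t ω)) ∂μ
      + ∫ ω, quad (P (t + 1)) (state f ξ (t + 1) ω) ∂μ =
    ∫ ω, quad (P t) (state f ξ t ω) ∂μ + (excess μ P f ξ t + unavoidableCost μ P ξ t) := by
  have hx := h.memLp_state f t ht.le fun s hs => hf s (by omega)
  have hu := hf t ht
  have hxu := memLp_sumElim hx hu
  set J := Θ.jointWeight t (P (t + 1)) with hJdef
  have hJ : J.PosSemidef := hP.jointWeight_posSemidef hcost ht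
  set G := fromCols (Θ.A t) (Θ.B t) with hG
  have hpred : MemLp (fun ω => G *ᵥ Sum.elim (state f ξ t ω) (input f ξ t ω)) 2 μ :=
    memLp_mulVec hxu G
  -- The input at time t uses measurements up to t - 1 only, so a correlation of w_t with v_t does
  -- no harm.
  have hind : IndepFun (fun ω => G *ᵥ Sum.elim (state f ξ t ω) (input f ξ t ω)) (ξ.w t) μ := by
    have hm := @measurable_traj Θ Ω (ξ.past t) ξ f t (ξ.measurableBefore_past ht.le)
    have hn := h.indepFun_noise ht hm
    have hg : Measurable fun q : Θ.StateSp t × Θ.History t =>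
        Θ.A t *ᵥ q.1 + Θ.B t *ᵥ f.act t q.2 :=
      ((measurable_mulVec _).comp measurable_fst).add
        ((measurable_mulVec _).comp ((f.measurable_act t).comp measurable_snd))
    have e : (fun ω => G *ᵥ Sum.elim (state f ξ t ω) (input f ξ t ω)) =
        (fun q : Θ.StateSp t × Θ.History t => Θ.A t *ᵥ q.1 + Θ.B t *ᵥ f.act t q.2) ∘
          fun ω => (state f ξ t ω, info f ξ t ω) := by
      funext ω
      rw [hG, fromCols_mulVec_sumElim]
      rfl
    rw [e]
    exact hn.comp hg measurable_fst
  have e1 : ∀ ω, state f ξ (t + 1) ω =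
      G *ᵥ Sum.elim (state f ξ t ω) (input f ξ t ω) + ξ.w t ω := fun ω => by
    rw [state_succ, hG, fromCols_mulVec_sumElim]
  have e2 : ∫ ω, quad (P (t + 1)) (state f ξ (t + 1) ω) ∂μ =
      ∫ ω, quad (P (t + 1)) (G *ᵥ Sum.elim (state f ξ t ω) (input f ξ t ω)) ∂μ
        + ∫ ω, quad (P (t + 1)) (ξ.w t ω) ∂μ := by
    simp only [e1]
    exact integral_quad_add_of_indepFun _ hpred (h.memLp_w ht) hind (h.mean_w t ht)
  have hK : MemLp (fun ω => input f ξ t ω - gain J *ᵥ state f ξ t ω) 2 μ :=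
    hu.sub (memLp_mulVec hx _)
  have e3 : ∫ ω, quad (P (t + 1)) (G *ᵥ Sum.elim (state f ξ t ω) (input f ξ t ω)) ∂μ
      + ∫ ω, quad (Θ.costWeight t) (Sum.elim (state f ξ t ω) (input f ξ t ω)) ∂μ =
      ∫ ω, quad (P t) (state f ξ t ω) ∂μ
        + ∫ ω, quad J.toBlocks₂₂ (input f ξ t ω - gain J *ᵥ state f ξ t ω) ∂μ := by
    rw [← integral_add (integrable_quad _ hpred) (integrable_quad _ hxu),
      ← integral_add (integrable_quad _ hx) (integrable_quad _ hK)]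
    congr 1
    funext ω
    rw [hP.step t ht, ← hJdef, ← quad_sumElim hJ, hJdef, jointWeight, quad_lift,
      transpose_transpose]
  have hz := h.memLp_filt ht.le hx
  have hdev : MemLp (deviation P f ξ t) 2 μ := hu.sub (memLp_mulVec hz _)
  have herr : MemLp (fun ω => -(gain J *ᵥ err ξ t ω)) 2 μ :=
    (memLp_mulVec (h.hasCov_err t ht.le).memLp _).neg
  have hmean : ∀ k, ∫ ω, (-(gain J *ᵥ err ξ t ω)) k ∂μ = 0 := fun k => by
    simp only [Pi.neg_apply]
    rw [integral_neg, ((h.hasCov_err t ht.le).mulVec (gain J)).mean k, neg_zero]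
  have hindK : IndepFun (deviation P f ξ t) (fun ω => -(gain J *ᵥ err ξ t ω)) μ := by
    have hg : Measurable fun i : Θ.History t => f.act t i - gain J *ᵥ Θ.filt t i :=
      (f.measurable_act t).sub ((measurable_mulVec _).comp (measurable_filt t))
    exact (h.indepFun_err_info hcov f t ht.le).symm.comp hg (measurable_mulVec (gain J)).neg
  -- Separation: u - Kx is the deviation, a function of the information, minus K times the error,
  -- which is centered and independent of the information. The cross terms vanish.
  have e4 : ∫ ω, quad J.toBlocks₂₂ (input f ξ t ω - gain J *ᵥ state f ξ t ω) ∂μ =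
      excess μ P f ξ t + ∫ ω, quad J.toBlocks₂₂ (-(gain J *ᵥ err ξ t ω)) ∂μ := by
    rw [excess, ← integral_quad_add_of_indepFun _ hdev herr hindK hmean]
    congr 1
    funext ω
    rw [deviation, state_eq_filt_add_err, mulVec_add, ← hJdef, ← sub_eq_add_neg, sub_sub]
  rw [unavoidableCost, ← hJdef]
  linarith

/-- The one-step identities telescope. Only the excess terms depend on the strategy, so minimizing
the cost means minimizing these. -/
lemma IsCostToGo.cost_eq (hP : Θ.IsCostToGo P) (hcost : Θ.CostPosSemidef)
    (hcov : Θ.CovPosSemidef) (h : ξ.HasLQGLaw μ) {f : Θ.Strategy} (hf : Admissible μ ξ f) :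
    cost μ ξ f = ∫ ω, quad (P 0) (ξ.x0 ω) ∂μ + ∑ t ∈ Finset.range Θ.T, unavoidableCost μ P ξ t
      + ∑ t ∈ Finset.range Θ.T, excess μ P f ξ t := by
  have hx : ∀ t ≤ Θ.T, MemLp (state f ξ t) 2 μ := fun t ht =>
    h.memLp_state f t ht fun s hs => hf s (by omega)
  have hstage : ∀ t ∈ Finset.range Θ.T, Integrable
      (fun ω => quad (Θ.costWeight t) (Sum.elim (state f ξ t ω) (input f ξ t ω))) μ :=
    fun t ht => integrable_quad _ (memLp_sumElim (hx t (Finset.mem_range.1 ht).le)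
      (hf t (Finset.mem_range.1 ht)))
  have key : ∀ k ≤ Θ.T, ∑ t ∈ Finset.range k,
      ∫ ω, quad (Θ.costWeight t) (Sum.elim (state f ξ t ω) (input f ξ t ω)) ∂μ
        + ∫ ω, quad (P k) (state f ξ k ω) ∂μ =
      ∫ ω, quad (P 0) (ξ.x0 ω) ∂μ + ∑ t ∈ Finset.range k, unavoidableCost μ P ξ t
        + ∑ t ∈ Finset.range k, excess μ P f ξ t := by
    intro k
    induction k with
    | zero =>
      intro _
      simp only [Finset.range_zero, Finset.sum_empty, zero_add, add_zero]
      rfl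
    | succ k ih =>
      intro hk
      have := hP.integral_step hcost hcov h hf (t := k) hk
      have := ih (by omega)
      simp only [Finset.sum_range_succ]
      linarith
  rw [← key Θ.T le_rfl, ← integral_finsetSum _ hstage, hP.final,
    ← integral_add (integrable_finsetSum _ hstage) (integrable_quad _ (hx Θ.T le_rfl))]
  rfl

lemma quad_nonneg {ι : Type*} [Fintype ι] {M : Matrix ι ι ℝ} (hM : M.PosSemidef) (z : ι → ℝ) :
    0 ≤ quad M z :=
  hM.dotProduct_mulVec_nonneg z

omit [IsProbabilityMeasure μ] in
lemma IsCostToGo.excess_nonneg (hP : Θ.IsCostToGo P) (hcost : Θ.CostPosSemidef) (f : Θ.Strategy)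
    {t : ℕ} (ht : t < Θ.T) : 0 ≤ excess μ P f ξ t :=
  integral_nonneg fun ω =>
    quad_nonneg ((hP.jointWeight_posSemidef hcost ht).submatrix Sum.inr) (deviation P f ξ t ω)

/-- The certainty equivalent control law. -/
noncomputable def certaintyEquivalent
    (P : ∀ t, Matrix (StateIdx (Θ.n t)) (StateIdx (Θ.n t)) ℝ) : Θ.Strategy where
  act t i := gain (Θ.jointWeight t (P (t + 1))) *ᵥ Θ.filt t i
  measurable_act t := (measurable_mulVec _).comp (measurable_filt t)

omit [MeasurableSpace Ω] in
lemma deviation_certaintyEquivalent (t : ℕ) (ω : Ω) :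
    deviation P (certaintyEquivalent P) ξ t ω = 0 :=
  sub_self _

lemma admissible_certaintyEquivalent (h : ξ.HasLQGLaw μ) :
    Admissible μ ξ (certaintyEquivalent P) := by
  intro t
  -- An input of this law is linear in the filter state, whose square integrability needs all
  -- earlier inputs.
  induction t using Nat.strong_induction_on with
  | _ t ih =>
    intro ht
    have hx := h.memLp_state (certaintyEquivalent P) t ht.le fun s hs => ih s hs (by omega)
    exact memLp_mulVec (h.memLp_filt ht.le hx) _

omit [IsProbabilityMeasure μ] in
lemma excess_certaintyEquivalent (t : ℕ) : excess μ P (certaintyEquivalent P) ξ t = 0 := by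
  simp only [excess, deviation_certaintyEquivalent, quad, mulVec_zero, dotProduct_zero,
    integral_zero]

lemma IsCostToGo.optimal (hP : Θ.IsCostToGo P) (hcost : Θ.CostPosSemidef)
    (hcov : Θ.CovPosSemidef) (h : ξ.HasLQGLaw μ) : Optimal μ ξ (certaintyEquivalent P) := by
  refine ⟨admissible_certaintyEquivalent h, fun g hg => ?_⟩
  rw [hP.cost_eq hcost hcov h (admissible_certaintyEquivalent h), hP.cost_eq hcost hcov h hg]
  simp only [excess_certaintyEquivalent]
  gcongr with t ht
  exact hP.excess_nonneg hcost g (Finset.mem_range.1 ht)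

/-- If the input weights are positive definite, an optimal strategy does not deviate from the
certainty equivalent control law. -/
lemma IsCostToGo.deviation_ae_eq_zero (hP : Θ.IsCostToGo P) (hcost : Θ.CostPosSemidef)
    (hcov : Θ.CovPosSemidef) (h : ξ.HasLQGLaw μ) (hR : ∀ t < Θ.T, (Θ.R t).PosDef)
    {g : Θ.Strategy} (hg : Optimal μ ξ g) {t : ℕ} (ht : t < Θ.T) :
    ∀ᵐ ω ∂μ, deviation P g ξ t ω = 0 := by
  have hle := hg.2 _ (admissible_certaintyEquivalent (P := P) h)
  rw [hP.cost_eq hcost hcov h (admissible_certaintyEquivalent h),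
    hP.cost_eq hcost hcov h hg.1] at hle
  simp only [excess_certaintyEquivalent, Finset.sum_const_zero] at hle
  have hnn : ∀ s ∈ Finset.range Θ.T, 0 ≤ excess μ P g ξ s := fun s hs =>
    hP.excess_nonneg hcost g (Finset.mem_range.1 hs)
  have hsum : ∑ s ∈ Finset.range Θ.T, excess μ P g ξ s = 0 :=
    -- Comparison with the certainty equivalent law, which has no excess, bounds the total excess
    -- above by zero.
    le_antisymm (by linarith) (Finset.sum_nonneg hnn)
  have hzero := (Finset.sum_eq_zero_iff_of_nonneg hnn).1 hsum t (Finset.mem_range.2 ht)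
  have hM := hP.toBlocks₂₂_posDef hcost ht (hR t ht)
  have hx := h.memLp_state g t ht.le fun s hs => hg.1 s (by omega)
  have hdev : MemLp (deviation P g ξ t) 2 μ :=
    (hg.1 t ht).sub (memLp_mulVec (h.memLp_filt ht.le hx) _)
  have hae := (integral_eq_zero_iff_of_nonneg (fun ω => quad_nonneg hM.posSemidef _)
    (integrable_quad _ hdev)).1 hzero
  filter_upwards [hae] with ω hω
  by_contra hne
  exact (hM.dotProduct_mulVec_pos hne).ne' hω

/-! ### Reduction to nodes 1, 3 and 5 -/

/-- On the estimates, the certainty equivalent gain only involves the nodes 1, 3 and 5. -/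
lemma IsCostToGo.gain_mulVec_filt (hP : Θ.IsCostToGo P) (hgraph : Θ.ConformsToGraph)
    (hA2 : Θ.AssumptionA2) (hcost : Θ.CostPosSemidef) (hcov : Θ.CovPosSemidef) {t : ℕ}
    (ht : t < Θ.T) (i : Θ.History t) :
    ((gain (Θ.jointWeight t (P (t + 1)))).submatrix id Subtype.val).mulVec
        (fun a : SubIdx (Θ.n t) funnel3 => Θ.filt t i a.1) =
      gain (Θ.jointWeight t (P (t + 1))) *ᵥ Θ.filt t i := by
  funext k
  refine submatrix_mulVec_subtype _ id _ k fun ⟨j, a⟩ hj => ?_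
  -- Nodes 2 and 4 drop out because their estimates vanish, node 6 because its gain column does.
  have hcases : (j = .n2 ∨ j = .n4) ∨ j = .n6 := by
    cases j <;> simp [funnel3] at hj ⊢
  rcases hcases with hj | hj
  · rw [filt_apply_eq_zero hgraph hA2 hcov t ht.le i _ hj, mul_zero]
  · exact mul_eq_zero_of_left (hP.gain_apply_eq_zero hgraph hA2 hcost ht k _ hj) _

omit [MeasurableSpace Ω] in
/-- The recursion of the estimates of the states of the nodes 1, 3 and 5. -/
lemma filt_info_succ_funnel3 (hgraph : Θ.ConformsToGraph) (hA2 : Θ.AssumptionA2)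
    (hcov : Θ.CovPosSemidef) (f : Θ.Strategy) {t : ℕ} (ht : t < Θ.T) (ω : Ω) :
    (fun a : SubIdx (Θ.n (t + 1)) funnel3 => Θ.filt (t + 1) (info f ξ (t + 1) ω) a.1) =
      ((Θ.A t).submatrix Subtype.val Subtype.val).mulVec
          (fun a : SubIdx (Θ.n t) funnel3 => Θ.filt t (info f ξ t ω) a.1)
        + ((Θ.B t).submatrix Subtype.val id).mulVec (input f ξ t ω)
        - ((Θ.filterGain t).submatrix Subtype.val id).mulVec (output f ξ t ω
            - ((Θ.C t).submatrix id Subtype.val).mulVec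
                (fun a : SubIdx (Θ.n t) anc3 => Θ.filt t (info f ξ t ω) a.1)) := by
  have hC : ((Θ.C t).submatrix id Subtype.val).mulVec
      (fun a : SubIdx (Θ.n t) anc3 => Θ.filt t (info f ξ t ω) a.1) =
        Θ.C t *ᵥ Θ.filt t (info f ξ t ω) := by
    funext k
    refine submatrix_mulVec_subtype _ id _ k fun ⟨j, c⟩ hj => ?_
    refine mul_eq_zero_of_left (hgraph.C_zero t ht j (fun hp => hj ?_) k c) _
    rcases hp.source_of_target_n1_n3 (.inr rfl) with rfl | rfl <;> simp [anc3]
  rw [hC]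
  funext a
  rw [filt_info_succ]
  have hA : (((Θ.A t).submatrix Subtype.val Subtype.val).mulVec
      (fun a : SubIdx (Θ.n t) funnel3 => Θ.filt t (info f ξ t ω) a.1)) a =
        (Θ.A t *ᵥ Θ.filt t (info f ξ t ω)) a.1 := by
    refine submatrix_mulVec_subtype _ Subtype.val _ a fun ⟨j, c⟩ hj => ?_
    -- The block A₅₂ may be nonzero, but it multiplies a zero estimate; node 6 has no path into {1,
    -- 3, 5}.
    have hcases : (j = .n2 ∨ j = .n4) ∨ j = .n6 := by
      cases j <;> simp [funnel3] at hj ⊢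
    rcases hcases with hj | hj
    · rw [filt_apply_eq_zero hgraph hA2 hcov t ht.le _ _ hj, mul_zero]
    · refine mul_eq_zero_of_left (hgraph.A_zero t ht _ j (fun hp => ?_) _ c) _
      have ha := a.2
      rw [hp.target_of_source_n6 hj] at ha
      simp [funnel3] at ha
  simp only [Pi.add_apply, Pi.sub_apply]
  rw [hA]
  rfl

end Params

end SixNode

theorem theorem3 (Θ : SixNode.Params) (hgraph : Θ.ConformsToGraph) (hA2 : Θ.AssumptionA2)
    (hcost : Θ.CostPosSemidef) (hcov : Θ.CovPosSemidef) :
    ∃ (K : ∀ t, Matrix (Fin (Θ.m t)) (SixNode.SubIdx (Θ.n t) SixNode.funnel3) ℝ)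
      (L : ∀ t, Matrix (SixNode.SubIdx (Θ.n (t + 1)) SixNode.funnel3) (Fin (Θ.p t)) ℝ)
      (f : Θ.Strategy),
      ∀ (Ω : Type*) [MeasurableSpace Ω] (μ : Measure Ω) [IsProbabilityMeasure μ]
        (ξ : Θ.Primitives Ω), ξ.HasLQGLaw μ →
        -- the strategy `f` is optimal and is given by the linear law `u = K z`
        (SixNode.Params.Optimal μ ξ f ∧
          ∀ t < Θ.T, SixNode.Params.input f ξ t =ᵐ[μ]
            fun ω => (K t).mulVec (SixNode.Params.estimate μ f ξ SixNode.funnel3 t ω)) ∧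
        -- if the input weights are positive definite, every optimal strategy is of this form
        ((∀ t < Θ.T, (Θ.R t).PosDef) →
          ∀ g : Θ.Strategy, SixNode.Params.Optimal μ ξ g →
            ∀ t < Θ.T, SixNode.Params.input g ξ t =ᵐ[μ]
              fun ω => (K t).mulVec (SixNode.Params.estimate μ g ξ SixNode.funnel3 t ω)) ∧
        -- the estimate obeys the recursion with the same gains `L` for all strategies
        (∀ g : Θ.Strategy, SixNode.Params.Admissible μ ξ g →
          ∀ t < Θ.T, SixNode.Params.estimate μ g ξ SixNode.funnel3 (t + 1) =ᵐ[μ]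
            fun ω =>
              ((Θ.A t).submatrix Subtype.val Subtype.val).mulVec
                  (SixNode.Params.estimate μ g ξ SixNode.funnel3 t ω)
                + ((Θ.B t).submatrix Subtype.val id).mulVec (SixNode.Params.input g ξ t ω)
                - (L t).mulVec (SixNode.Params.output g ξ t ω
                    - ((Θ.C t).submatrix id Subtype.val).mulVec
                        (SixNode.Params.estimate μ g ξ SixNode.anc3 t ω))) := by
  obtain ⟨P, hP⟩ := Θ.exists_isCostToGo
  -- Gains and strategy are built from the parameters alone, before any probability space is
  -- introduced.
  refine ⟨fun t => (SixNode.gain (Θ.jointWeight t (P (t + 1)))).submatrix id Subtype.val,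
    fun t => (Θ.filterGain t).submatrix Subtype.val id,
    SixNode.Params.certaintyEquivalent P, ?_⟩
  intro Ω _ μ _ ξ h
  have hopt : SixNode.Params.Optimal μ ξ (SixNode.Params.certaintyEquivalent P) :=
    hP.optimal hcost hcov h
  refine ⟨⟨hopt, fun t ht => ?_⟩, fun hR g hg t ht => ?_, fun g hg t ht => ?_⟩
  · filter_upwards [h.estimate_ae_eq hcov hopt.1 SixNode.funnel3 ht.le] with ω hω
    rw [hω, hP.gain_mulVec_filt hgraph hA2 hcost hcov ht]
    rfl
  · filter_upwards [h.estimate_ae_eq hcov hg.1 SixNode.funnel3 ht.le,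
      hP.deviation_ae_eq_zero hcost hcov h hR hg ht] with ω hω hdev
    rw [hω, hP.gain_mulVec_filt hgraph hA2 hcost hcov ht]
    exact sub_eq_zero.1 hdev
  · filter_upwards [h.estimate_ae_eq hcov hg SixNode.funnel3 ht,
      h.estimate_ae_eq hcov hg SixNode.funnel3 ht.le,
      h.estimate_ae_eq hcov hg SixNode.anc3 ht.le] with ω h1 h2 h3
    rw [h1, h2, h3]
    exact SixNode.Params.filt_info_succ_funnel3 hgraph hA2 hcov g ht ω
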